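/- **Model.** $n$ agents with distinct identifiers from $\{1,\dots,N\}$, $N\ge n>4$, are at distinct points of a circle of circumference $1$. Each agent knows $N$ and its own identifier, and has its own sense of direction (its "right" is clockwise or anticlockwise; the senses need not agree). Time is divided into synchronous rounds of length $1$. In each round every agent starts moving at unit speed to its right or to its left; whenever two agents collide, both reverse their direction. In the *perceptive* model an agent learns, at the end of each round, (i) $\mathrm{dist}$, the distance from its position at the start to its position at the end of the round, measured in its own clockwise direction, and (ii) $\mathrm{coll}$, the distance between its position at the start of the round and the position of its first collision in the round (if it has a collision). The agents run a common deterministic algorithm, and have no other means of communication. The *rotation index* of a round is the number $r\in\{0,\dots,n-1\}$ of places by which every agent moves clockwise along the ring of agents in that round; the round is a *nontrivial move* if $r\notin\{0,n/2\}$. The *nontrivial move problem* is solved when all agents have terminated and each agent $a$ has a direction $\mathrm{dir}_a$ such that the round in which each agent $a$ starts in direction $\mathrm{dir}_a$ is a nontrivial move. **Selective families.** A sequence $\mathcal F$ of subsets of $[N]=\{1,\dots,N\}$ is *$(N,m)$-selective* if for every nonempty $Z\subseteq[N]$ with $|Z|\le m$ there is $S\in\mathcal F$ with $|Z\cap S|=1$.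 **Algorithm NMoveS**, for given $(N,2^k)$-selective families $\mathcal F_{N,k}$ ($2^k\le N$). To *test* an assignment of directions, the agents run two consecutive rounds with these directions; each agent reports a nontrivial move iff the observed values satisfy $\mathrm{dist}_1\ne0$ and $\mathrm{dist}_1+\mathrm{dist}_2\ne1$. 1. All agents test the direction right, and return it if it gives a nontrivial move. 2. *Neighbour discovery* (each round is followed by its reversal): for every bit position $i$, $j\in\{0,1\}$ and $k\in\{\text{left},\text{right}\}$, an agent moves in direction $k$ if the $i$th bit of its identifier is $j$ and in the opposite direction otherwise; then all agents move right, and then all agents move left. The distance to the neighbour on either side is twice the smallest value of $\mathrm{coll}$ observed when starting towards that side. The neighbour on the right (left) has the opposite sense of direction iff this smallest value was observed in the round in which all agents move right (left). From now on neighbours can exchange one bit in $O(1)$ rounds: an agent moves right for bit $1$ and left for bit $0$, then the reverse, and each agent decodes its neighbour's bit by whether it first collides at the middle point between them. 3. All agents are local leaders. For $k=0,1,\dots,\lfloor\log_2N\rfloor$: - The local leaders disseminate their identifiers to ring distance $2^k$ by bitwise pipelining over the one-bit neighbour communication (local leaders do not forward foreign messages). A local leader keeps its status iff its identifier is the largest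 one among those of the local leaders it has received. - For each $S\in\mathcal F_{N,k}$ in turn, the agents test the assignment in which the local leaders with identifier in $S$ start left and all other agents start right; if it gives a nontrivial move, all agents return these directions. **Lemma.** There are a constant $c$ and $(N,2^k)$-selective families $\mathcal F_{N,k}$ with $|\mathcal F_{N,k}|\le c\,2^k\log N$ for all $N>2$ and all $k\geq 0$ with $2^k\le N$. For every $c$ there is a constant $C$ such that, for all families $\mathcal F_{N,k}$ with these properties, for all $N\ge n>4$, all initial positions, all senses of direction and all assignments of distinct identifiers from $[N]$, the algorithm NMoveS terminates and solves the nontrivial move problem in the perceptive model within $C\sqrt n\,\log N$ rounds. -/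

import Mathlib

open Set Filter Topology

/-! ### Agents: directions, observations, programs -/

/-- The two directions an agent may choose, according to its own sense of direction:
`right` is its own clockwise direction. -/
inductive Dir : Type
  | right
  | left
  deriving DecidableEq

/-- The opposite direction. -/
def Dir.opp : Dir → Dir
  | .right => .left
  | .left => .right

/-- `+1` for right and `-1` for left. -/
def Dir.sign : Dir → ℤˣ
  | .right => 1
  | .left => -1

/-- What an agent learns at the end of a round of the perceptive model: `dist` is the distance,
measured in the agent's own clockwise direction, from its position at the beginning to its position
at the end of the round; `coll` is the distance between its position at the beginning of the round
and the position of its first collision in the round (`none` if it does not collide). -/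
structure Obs : Type where
  dist : ℝ
  coll : Option ℝ

/-- Deterministic programs of an agent in the perceptive model that return a value of type `α`:
either the program has terminated, or it starts the next round in some direction and continues
depending on what it observes in that round. There is no way to stay idle in a round. -/
inductive AgentProg (α : Type) : Type
  | done (a : α) : AgentProg α
  | move (d : Dir) (next : Obs → AgentProg α) : AgentProg α

/-- Sequential composition of programs. -/
def AgentProg.bind {α β : Type} : AgentProg α → (α → AgentProg β) → AgentProg β
  | .done a, f => f a
  | .move d next, f => .move d (fun o => (next o).bind f)

instance : Monad AgentProg where
  pure := AgentProg.done
  bind := AgentProg.bind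

/-! ### The ring and the motion of the agents during one round

The ring is the circle `UnitAddCircle = ℝ / ℤ` of circumference one; the objective clockwise
direction is the positive one. -/

/-- Agent `i` is at the same point as another agent at time `t`. -/
def Meets {n : ℕ} (X : Fin n → ℝ → UnitAddCircle) (i : Fin n) (t : ℝ) : Prop :=
  ∃ j, j ≠ i ∧ X j t = X i t

/-- `X` describes the motion of the agents during one round, i.e. during the time interval `[0, 1]`:
they start at the points `p` with the velocities `v₀`; at each time `t` agent `i` arrives with
constant velocity `vin i t` and leaves with constant velocity `vout i t`; the velocity is reversed
when the agent collides with another one, and it is unchanged otherwise. -/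
structure IsMotion {n : ℕ} (p : Fin n → UnitAddCircle) (v₀ : Fin n → ℝ)
    (X : Fin n → ℝ → UnitAddCircle) (vin vout : Fin n → ℝ → ℝ) : Prop where
  start : ∀ i, X i 0 = p i
  launch : ∀ i, vout i 0 = v₀ i
  leave : ∀ i, ∀ t ∈ Ico (0 : ℝ) 1,
    ∀ᶠ s in 𝓝[>] t, X i s = X i t + ((vout i t * (s - t) : ℝ) : UnitAddCircle)
  arrive : ∀ i, ∀ t ∈ Ioc (0 : ℝ) 1,
    ∀ᶠ s in 𝓝[<] t, X i t = X i s + ((vin i t * (t - s) : ℝ) : UnitAddCircle)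
  bounce : ∀ i, ∀ t ∈ Ioo (0 : ℝ) 1, Meets X i t → vout i t = -vin i t
  keep : ∀ i, ∀ t ∈ Ioo (0 : ℝ) 1, ¬ Meets X i t → vout i t = vin i t

/-- `c` is the distance between the position of agent `i` at the beginning of the round and the
position of its first collision in the round, and `none` if it has no collision. -/
def IsColl {n : ℕ} (X : Fin n → ℝ → UnitAddCircle) (i : Fin n) : Option ℝ → Prop
  | some c => ∃ t ∈ Icc (0 : ℝ) 1, Meets X i t ∧ (∀ s ∈ Ico (0 : ℝ) t, ¬ Meets X i s) ∧
      c = dist (X i 0) (X i t)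
  | none => ∀ t ∈ Icc (0 : ℝ) 1, ¬ Meets X i t

/-- One round of the perceptive model. The agents are at the points `p` at the beginning and at the
points `q` at the end of the round; agent `i` starts the round in its own direction `d i` and
observes `o i`. Its sense of direction is `σ i`: it is `1` if its own clockwise direction is the
objective one, and `-1` otherwise. -/
def IsRound {n : ℕ} (σ : Fin n → ℤˣ) (p : Fin n → UnitAddCircle) (d : Fin n → Dir)
    (o : Fin n → Obs) (q : Fin n → UnitAddCircle) : Prop :=
  ∃ (X : Fin n → ℝ → UnitAddCircle) (vin vout : Fin n → ℝ → ℝ),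
    IsMotion p (fun i => (((σ i * (d i).sign : ℤˣ) : ℤ) : ℝ)) X vin vout ∧
    ∀ i, q i = X i 1 ∧
      ((o i).dist ∈ Ico (0 : ℝ) 1 ∧
        q i = p i + (((((σ i : ℤˣ) : ℤ) : ℝ) * (o i).dist : ℝ) : UnitAddCircle)) ∧
      IsColl X i (o i).coll

/-- `Run σ P p t a q`: when all agents start at the points `p` and simultaneously execute their
programs `P`, then after exactly `t` rounds all of them have terminated, agent `i` with the value
`a i`, at the points `q`. -/
inductive Run {n : ℕ} {α : Type} (σ : Fin n → ℤˣ) :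
    (Fin n → AgentProg α) → (Fin n → UnitAddCircle) → ℕ →
    (Fin n → α) → (Fin n → UnitAddCircle) → Prop
  | halt (P : Fin n → AgentProg α) (p : Fin n → UnitAddCircle) (a : Fin n → α)
      (hP : ∀ i, P i = AgentProg.done (a i)) : Run σ P p 0 a p
  | step (P : Fin n → AgentProg α) (d : Fin n → Dir) (next : Fin n → Obs → AgentProg α)
      (o : Fin n → Obs) (p p' q : Fin n → UnitAddCircle) (t : ℕ) (a : Fin n → α)
      (hP : ∀ i, P i = AgentProg.move (d i) (next i))
      (hround : IsRound σ p d o p')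
      (hrest : Run σ (fun i => next i (o i)) p' t a q) : Run σ P p (t + 1) a q

/-! ### The nontrivial move problem -/

/-- The agents, numbered in clockwise order, are at `p` before and at `q` after a round with
rotation index `r`: each of them moves clockwise by `r` places. -/
def HasRotationIndex {n : ℕ} (p q : Fin n → UnitAddCircle) (r : ℕ) : Prop :=
  r < n ∧ ∀ i, q i = p ((finRotate n ^ r) i)

/-- The rotation index is neither `0` nor `n / 2`. -/
def IsNontrivialMove {n : ℕ} (p q : Fin n → UnitAddCircle) : Prop :=
  ∃ r, HasRotationIndex p q r ∧ r ≠ 0 ∧ 2 * r ≠ n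

/-- If each agent `i` starts the next round in direction `d i`, that round is a nontrivial move. -/
def GivesNontrivialMove {n : ℕ} (σ : Fin n → ℤˣ) (p : Fin n → UnitAddCircle)
    (d : Fin n → Dir) : Prop :=
  (∃ o q, IsRound σ p d o q) ∧ ∀ o q, IsRound σ p d o q → IsNontrivialMove p q

/-- Executed from the points `p`, the programs `P` terminate after at most `T` rounds, and they
assign to the agents directions that give a nontrivial move. -/
def SolvesNontrivialMoveWithin {n : ℕ} (σ : Fin n → ℤˣ) (p : Fin n → UnitAddCircle)
    (P : Fin n → AgentProg Dir) (T : ℝ) : Prop :=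
  (∃ t d q, Run σ P p t d q) ∧
    ∀ t d q, Run σ P p t d q → (t : ℝ) ≤ T ∧ GivesNontrivialMove σ q d

/-! ### Selective families -/

/-- A sequence of subsets of `[N]` is `(N, m)`-selective: every nonempty `Z ⊆ [N]` with at most `m`
elements meets one of the sets in exactly one element. -/
def IsSelective (N m : ℕ) (F : List (Finset ℕ)) : Prop :=
  (∀ S ∈ F, S ⊆ Finset.Icc 1 N) ∧
    ∀ Z ⊆ Finset.Icc 1 N, Z.Nonempty → Z.card ≤ m → ∃ S ∈ F, (Z ∩ S).card = 1

/-- `F N k` is an `(N, 2 ^ k)`-selective family of size at most `c * 2 ^ k * log N`,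
whenever `N > 2` and `2 ^ k ≤ N`. -/
def IsSelectiveScheme (c : ℝ) (F : ℕ → ℕ → List (Finset ℕ)) : Prop :=
  ∀ N k, 2 < N → 2 ^ k ≤ N →
    IsSelective N (2 ^ k) (F N k) ∧ ((F N k).length : ℝ) ≤ c * 2 ^ k * Real.log N

/-! ### The algorithm -/

noncomputable section

/-- One round started in direction `d`. -/
def singleRound (d : Dir) : AgentProg Obs := .move d .done

/-- A round in direction `d`, followed by a round in the opposite direction, which brings all agents
back. The observation of the first round is returned. -/
def roundTrip (d : Dir) : AgentProg Obs := do
  let o ← singleRound d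
  let _ ← singleRound d.opp
  pure o

/-- Two rounds with the same directions, after which each agent knows whether these directions give
a nontrivial move. -/
def testMove (d : Dir) : AgentProg Bool := do
  let o₁ ← singleRound d
  let o₂ ← singleRound d
  pure (decide (o₁.dist ≠ 0 ∧ o₁.dist + o₂.dist ≠ 1))

/-- What an agent knows about its neighbours on its two sides: their distances, and whether they
have the same sense of direction. -/
structure NeighborInfo : Type where
  gap : Dir → ℝ
  same : Dir → Bool

/-- Adds the observed distance (if any) to the set of distances to collisions on side `d`. -/
def addColl (D : Dir → Set ℝ) (d : Dir) (o : Obs) : Dir → Set ℝ :=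
  Function.update D d (D d ∪ {x | o.coll = some x})

/-- A round in direction `k` if the `i`th bit of the ID is `j`, and in the opposite direction
otherwise. -/
def probe (id : ℕ) (D : Dir → Set ℝ) (q : ℕ × Bool × Dir) : AgentProg (Dir → Set ℝ) := do
  let d : Dir := if id.testBit q.1 = q.2.1 then q.2.2 else q.2.2.opp
  let o ← roundTrip d
  pure (addColl D d o)

/-- Neighbour discovery: all bits `i`, all `j ∈ {0, 1}` and `k ∈ {left, right}` are probed, then all
agents start right, and then all agents start left. -/
def neighborDiscovery (N id : ℕ) : AgentProg NeighborInfo := do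
  let D ← (List.range N.size ×ˢ [false, true] ×ˢ [Dir.left, Dir.right]).foldlM
    (probe id) (fun _ => ∅)
  let oR ← roundTrip .right
  let D := addColl D .right oR
  let oL ← roundTrip .left
  let D := addColl D .left oL
  pure {
    gap := fun s => 2 * sInf (D s)
    same := fun s => match s with
      | .right => decide (oR.coll ≠ some (sInf (D .right)))
      | .left => decide (oL.coll ≠ some (sInf (D .left))) }

/-- Each agent transmits one bit `z` to both neighbours and returns the bits of its neighbours. The
bit of the neighbour on side `s` is determined in the round that the agent starts towards `s`:
this round is clear if the agent first collides in the middle between it and that neighbour. -/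
def exchangeBit (nb : NeighborInfo) (z : Bool) : AgentProg (Dir → Bool) := do
  let o₁ ← roundTrip (if z then .right else .left)
  let o₃ ← roundTrip (if z then .left else .right)
  pure fun s =>
    let o : Obs := if s = (if z then Dir.right else Dir.left) then o₁ else o₃
    let clear : Bool := decide (o.coll = some (nb.gap s / 2))
    if clear = nb.same s then !z else z

/-- Each agent transmits the bit `z s` to its neighbour on side `s`, for both sides, and returns the
bits transmitted to it from both sides. -/
def exchangeBits (nb : NeighborInfo) (z : Dir → Bool) : AgentProg (Dir → Bool) := do
  let a ← exchangeBit nb (z .right)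
  let b ← exchangeBit nb (z .left)
  pure fun s =>
    let side : Dir := if nb.same s then s.opp else s
    match side with
    | .right => a s
    | .left => b s

/-- As `exchangeBits`, for symbols that are a bit or `none` (nothing to transmit): `00` and `11`
encode the two bits and `01` encodes `none`. -/
def exchangeSymbols (nb : NeighborInfo) (z : Dir → Option Bool) :
    AgentProg (Dir → Option Bool) := do
  let x ← exchangeBits nb (fun s => (z s).getD false)
  let y ← exchangeBits nb (fun s => (z s).getD true)
  pure fun s => if x s = y s then some (x s) else none

/-- The state of a dissemination: the symbols that arrived last, and all bits that arrived so far,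
from both sides. -/
structure DissState : Type where
  last : Dir → Option Bool
  buf : Dir → List Bool

/-- Step `q` of a dissemination. A marked agent (`msg = some m`) sends the `q`th bit of its message
to both sides; any other agent passes on what arrived in the previous step. -/
def dissStep (nb : NeighborInfo) (msg : Option (List Bool)) (st : DissState) (q : ℕ) :
    AgentProg DissState := do
  let out : Dir → Option Bool := match msg with
    | some m => fun _ => m[q]?
    | none => fun s => st.last s.opp
  let inc ← exchangeSymbols nb out
  pure { last := inc, buf := fun s => st.buf s ++ (inc s).toList }

/-- Sparse dissemination of messages of `len` bits on ring distance `d`, in `len + d - 1` steps.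
Returned are the messages that arrived completely, from both sides. -/
def disseminate (nb : NeighborInfo) (msg : Option (List Bool)) (len d : ℕ) :
    AgentProg (Dir → Option (List Bool)) := do
  let st ← (List.range (len + d - 1)).foldlM (dissStep nb msg)
    { last := fun _ => none, buf := fun _ => [] }
  pure fun s => if (st.buf s).length = len then some (st.buf s) else none

/-- The bits of an ID, least significant bit first. -/
def idBits (N id : ℕ) : List Bool := (List.range N.size).map id.testBit

/-- The number with the given bits, least significant bit first. -/
def bitsToNat (l : List Bool) : ℕ := l.foldr Nat.bit 0

/-- Execution of a family on the local leaders, until a nontrivial move appears: in the round of the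
set `S`, the local leaders with an ID in `S` start left, and all other agents keep
the direction right. -/
def executeFamily (leader : Bool) (id : ℕ) : List (Finset ℕ) → AgentProg (Option Dir)
  | [] => pure none
  | S :: rest => do
    let d : Dir := if leader = true ∧ id ∈ S then .left else .right
    let nontrivial ← testMove d
    if nontrivial then pure (some d) else executeFamily leader id rest

open Classical in
/-- The main loop over the exponents `k` in the given list: the IDs of the local leaders are
disseminated on ring distance `2 ^ k`; a local leader keeps this status if its ID is the largest
one among those it knows; the `(N, 2 ^ k)`-selective family is executed on the local leaders. -/
def mainLoop (F : ℕ → ℕ → List (Finset ℕ)) (N id : ℕ) (nb : NeighborInfo) :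
    List ℕ → Bool → AgentProg Dir
  | [], _ => pure .right
  | k :: ks, leader => do
    let heard ← disseminate nb (if leader then some (idBits N id) else none) N.size (2 ^ k)
    let leader' : Bool := leader && decide (∀ s m, heard s = some m → bitsToNat m ≤ id)
    let result ← executeFamily leader' id (F N k)
    match result with
    | some d => pure d
    | none => mainLoop F N id nb ks leader'

/-- The algorithm NMoveS, executed by an agent with identifier `id` that knows `N`,
with the selective families `F N k`. -/
def NMoveS (F : ℕ → ℕ → List (Finset ℕ)) (N id : ℕ) : AgentProg Dir := do
  let nontrivial ← testMove .right
  if nontrivial then pure .right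
  else do
    let nb ← neighborDiscovery N id
    mainLoop F N id nb (List.range (Nat.log 2 N + 1)) true

end

/-! Reversing at a collision differs from passing through only in the names of the points. On the
universal cover the agents, numbered by `ℤ`, therefore follow ghosts of constant velocity `±1`, and
each meeting swaps the two ghosts that meet. In one round every ghost makes a full turn, so the set
of occupied points is restored. Agents never overtake each other, so all of them shift by the same
number of places. Swaps have zero total displacement and the full turns contribute `n` times the sum
of the velocities, so that number is the sum of the velocities (`track_one`). A round with net
velocity `s` is thus nontrivial iff `n ∤ 2 * s`, and `dist_test_iff` shows that each agent can read
this off two values of `dist`. A failed test moves everybody by a multiple of `n` places, that is,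
not at all.

Until its first collision an agent coincides with its own ghost, so the collision is at half the gap
to the neighbour ahead if that neighbour approaches, and further away otherwise (`CollSpec`). This
yields neighbour discovery, the exchange of bits, and dissemination at one ring place per step.

In phase `k`, local leaders at ring distance at most `2 ^ k` without a leader between them compare
identifiers, so by induction the survivors are more than `2 ^ k` apart (`Separated.nextLeaders`),
while the leader with the largest identifier always survives. For `K` with `2 ^ K ≤ n ≤ 4 ^ K`, at
most `2 ^ K` leaders are left in phase `K`, and the selective family isolates one of them. Turning a
single agent changes twice the net velocity by `±4`; if both this assignment and the all-right one
were trivial, `n` would divide `4`. Hence the loop stops by phase `K`. With `2 ^ K ≤ 2 * √n` the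
costs of the phases form a geometric sum of order `√n * log N`.

Selective families come from the probabilistic method: a random set of density `1 / (2 * t)`
isolates an element of a given set of size in `(t / 2, t]` with probability at least `1 / 8`. Sets
are chosen greedily, and dyadic sizes are concatenated (`exists_isSelective`).

As the correctness statement speaks of every run, motions, rounds and runs are also shown to be
unique (`IsMotion.unique`, `Run.unique`). -/

/-! ### Agents numbered by integers -/

/-- The agent with number `k` modulo `n`. -/
def agentAt (n : ℕ) [NeZero n] (k : ℤ) : Fin n :=
  ⟨(k % n).toNat, by
    have hn : (0 : ℤ) < n := by exact_mod_cast Nat.pos_of_ne_zero (NeZero.ne n)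
    have := Int.emod_lt_of_pos k hn
    have := Int.emod_nonneg k hn.ne'
    omega⟩

section AgentAt

variable {n : ℕ} [NeZero n]

theorem intCast_pos_of_neZero : (0 : ℤ) < n := by
  exact_mod_cast Nat.pos_of_ne_zero (NeZero.ne n)

theorem agentAt_val (k : ℤ) : ((agentAt n k : ℕ) : ℤ) = k % n :=
  Int.toNat_of_nonneg (Int.emod_nonneg k (intCast_pos_of_neZero (n := n)).ne')

theorem agentAt_eq_iff {k l : ℤ} : agentAt n k = agentAt n l ↔ (n : ℤ) ∣ k - l := by
  rw [Fin.ext_iff, ← Int.natCast_inj, agentAt_val, agentAt_val,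
    Int.emod_eq_emod_iff_emod_sub_eq_zero, Int.dvd_iff_emod_eq_zero]

@[simp] theorem agentAt_natCast (i : Fin n) : agentAt n ((i : ℕ) : ℤ) = i := by
  rw [Fin.ext_iff, ← Int.natCast_inj, agentAt_val]
  exact Int.emod_eq_of_lt (by positivity) (by exact_mod_cast i.2)

theorem agentAt_add_mul (k m : ℤ) : agentAt n (k + n * m) = agentAt n k :=
  agentAt_eq_iff.2 ⟨m, by ring⟩

theorem agentAt_add_period (k : ℤ) : agentAt n (k + n) = agentAt n k :=
  agentAt_eq_iff.2 ⟨1, by ring⟩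

theorem agentAt_val_add (k l : ℤ) :
    agentAt n (((agentAt n k : ℕ) : ℤ) + l) = agentAt n (k + l) := by
  rw [agentAt_eq_iff, agentAt_val]
  refine ⟨-(k / n), ?_⟩
  have := Int.emod_add_mul_ediv k n
  linarith

theorem agentAt_eq_add_mul {k l : ℤ} (h : agentAt n k = agentAt n l) : ∃ m : ℤ, k = l + n * m := by
  obtain ⟨m, hm⟩ := agentAt_eq_iff.1 h
  exact ⟨m, by linarith⟩

/-- A function that increases by `c` over each period increases by `m • c` over `m` periods. -/
theorem map_add_mul_of_period {M : Type*} [AddCommGroup M] {n : ℕ} {f : ℤ → M} {c : M}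
    (hf : ∀ k, f (k + n) = f k + c) (k m : ℤ) : f (k + n * m) = f k + m • c := by
  induction m using Int.induction_on with
  | zero => simp
  | succ m ih =>
    rw [show k + (n : ℤ) * (m + 1) = k + n * m + n by ring, hf, ih, add_zsmul, one_zsmul, add_assoc]
  | pred m ih =>
    have := hf (k + n * (-m - 1))
    rw [show k + (n : ℤ) * (-m - 1) + n = k + n * (-m) by ring, ih] at this
    rw [sub_zsmul, one_zsmul, eq_sub_of_add_eq this.symm, add_sub_assoc, sub_eq_add_neg]

/-- The sum of a periodic function over one period is invariant under periodic permutations. -/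
theorem sum_periodic_comp_perm {M : Type*} [AddCommGroup M] (f : ℤ → M)
    (hf : ∀ k, f (k + n) = f k) (π : Equiv.Perm ℤ) (hπ : ∀ k, π (k + n) = π k + n) :
    ∑ i : Fin n, f (π (i : ℕ)) = ∑ i : Fin n, f (i : ℕ) := by
  have hfm : ∀ k m : ℤ, f (k + n * m) = f k := fun k m => by
    simpa using map_add_mul_of_period (f := fun k => f k) (c := 0) (by simpa using hf) k m
  have hπm : ∀ k m : ℤ, π (k + n * m) = π k + n * m := fun k m => by
    rw [map_add_mul_of_period hπ, smul_eq_mul, mul_comm m]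
  -- `π` descends to the residues modulo `n`; on a finite set injectivity makes the induced map a
  -- bijection.
  have hinj : Function.Injective (fun i : Fin n => agentAt n (π (i : ℕ))) := by
    intro i j hij
    obtain ⟨m, hm⟩ := agentAt_eq_add_mul hij
    rw [← hπm] at hm
    have h2 := congrArg (agentAt n) (π.injective hm)
    rwa [agentAt_add_mul, agentAt_natCast, agentAt_natCast] at h2
  have hbij := hinj.bijective_of_finite
  rw [← hbij.sum_comp (fun i : Fin n => f (i : ℕ))]
  refine Finset.sum_congr rfl fun i _ => ?_
  obtain ⟨m, hm⟩ := agentAt_eq_add_mul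
    (show agentAt n ((agentAt n (π (i : ℕ)) : ℕ) : ℤ) = agentAt n (π (i : ℕ)) by simp)
  rw [hm, hfm]

end AgentAt

/-- A strictly increasing enumeration of the lifts of the positions of `n` agents to the line. -/
structure IsRingLift (n : ℕ) (y : ℤ → ℝ) : Prop where
  mono : StrictMono y
  period : ∀ k, y (k + n) = y k + 1

theorem IsRingLift.shift {n : ℕ} {y : ℤ → ℝ} (hy : IsRingLift n y) (m : ℤ) :
    IsRingLift n (fun k => y (k + m)) where
  mono := fun a b h => hy.mono (by linarith)
  period := fun k => by rw [← hy.period]; ring_nf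

theorem IsRingLift.add_mul {n : ℕ} {y : ℤ → ℝ} (hy : IsRingLift n y) (k m : ℤ) :
    y (k + n * m) = y k + m := by
  simpa using map_add_mul_of_period hy.period k m

/-! ### Ghosts: points that pass through each other -/

noncomputable section

/-- The position at time `t` of the point that starts at `y k` and keeps its velocity `v k`. -/
def ghost (y : ℤ → ℝ) (v : ℤ → ℤˣ) (k : ℤ) (t : ℝ) : ℝ := y k + ((v k : ℤ) : ℝ) * t

variable {y : ℤ → ℝ} {v : ℤ → ℤˣ}

theorem ghost_sub (k : ℤ) (s t : ℝ) :
    ghost y v k s = ghost y v k t + ((v k : ℤ) : ℝ) * (s - t) := by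
  unfold ghost; ring

theorem ghost_injective_of_eq (hy : StrictMono y) {j k : ℤ} {t : ℝ} (hv : v j = v k)
    (h : ghost y v j t = ghost y v k t) : j = k := by
  unfold ghost at h
  rw [hv] at h
  exact hy.injective (by linarith)

theorem units_eq_of_ne_of_ne {a b c : ℤˣ} (h1 : a ≠ c) (h2 : b ≠ c) : a = b := by
  rcases Int.units_eq_one_or a with rfl | rfl <;> rcases Int.units_eq_one_or b with rfl | rfl <;>
    rcases Int.units_eq_one_or c with rfl | rfl <;> simp_all

theorem units_eq_neg_of_ne {a b : ℤˣ} (h : a ≠ b) : a = -b := by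
  rcases Int.units_eq_one_or a with rfl | rfl <;> rcases Int.units_eq_one_or b with rfl | rfl <;>
    simp_all

/-- Ghosts of equal velocity never meet and there are only two velocities, so at most two ghosts
share a point. This makes meetings pairwise and the swap an involution. -/
theorem ghost_meet_unique (hy : StrictMono y) {j k l : ℤ} {t : ℝ} (hj : j ≠ k) (hl : l ≠ k)
    (h1 : ghost y v j t = ghost y v k t) (h2 : ghost y v l t = ghost y v k t) : j = l := by
  have a : v j ≠ v k := fun h => hj (ghost_injective_of_eq hy h h1)
  have b : v l ≠ v k := fun h => hl (ghost_injective_of_eq hy h h2)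
  exact ghost_injective_of_eq hy (units_eq_of_ne_of_ne a b) (h1.trans h2.symm)

open Classical in
/-- The ghost that is at the same point as ghost `k` at time `t`, if any, and `k` otherwise. -/
def ghostPartner (y : ℤ → ℝ) (v : ℤ → ℤˣ) (t : ℝ) (k : ℤ) : ℤ :=
  if h : ∃ j, j ≠ k ∧ ghost y v j t = ghost y v k t then h.choose else k

theorem ghost_ghostPartner (t : ℝ) (k : ℤ) :
    ghost y v (ghostPartner y v t k) t = ghost y v k t := by
  unfold ghostPartner
  split_ifs with h
  · exact h.choose_spec.2
  · rfl

theorem ghostPartner_eq (hy : StrictMono y) {t : ℝ} {j k : ℤ} (hj : j ≠ k)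
    (h : ghost y v j t = ghost y v k t) : ghostPartner y v t k = j := by
  have hex : ∃ j, j ≠ k ∧ ghost y v j t = ghost y v k t := ⟨j, hj, h⟩
  unfold ghostPartner
  rw [dif_pos hex]
  exact ghost_meet_unique hy hex.choose_spec.1 hj hex.choose_spec.2 h

theorem ghostPartner_involutive (hy : StrictMono y) (t : ℝ) :
    Function.Involutive (ghostPartner y v t) := by
  intro k
  by_cases h : ghostPartner y v t k = k
  · rw [h, h]
  · exact ghostPartner_eq hy (Ne.symm h) (ghost_ghostPartner t k).symm

/-- At time `t`, ghosts at the same point are swapped. -/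
def ghostSwap (hy : StrictMono y) (v : ℤ → ℤˣ) (t : ℝ) : Equiv.Perm ℤ :=
  (ghostPartner_involutive (v := v) hy t).toPerm

theorem ghost_ghostSwap (hy : StrictMono y) (t : ℝ) (k : ℤ) :
    ghost y v (ghostSwap hy v t k) t = ghost y v k t := ghost_ghostPartner t k

theorem ghostSwap_eq (hy : StrictMono y) {t : ℝ} {j k : ℤ} (hj : j ≠ k)
    (h : ghost y v j t = ghost y v k t) : ghostSwap hy v t k = j := ghostPartner_eq hy hj h

theorem ghostSwap_mul_self (hy : StrictMono y) (t : ℝ) :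
    ghostSwap hy v t * ghostSwap hy v t = 1 := by
  ext k; exact ghostPartner_involutive hy t k

theorem velocity_ghostSwap (hy : StrictMono y) {t : ℝ} {k : ℤ} (h : ghostSwap hy v t k ≠ k) :
    v (ghostSwap hy v t k) = -v k :=
  units_eq_neg_of_ne fun hv => h (ghost_injective_of_eq hy hv (ghost_ghostSwap hy t k))

theorem ghostSwap_zero (hy : StrictMono y) : ghostSwap hy v 0 = 1 := by
  ext k
  have := ghost_ghostSwap (v := v) hy 0 k
  simp only [ghost, mul_zero, add_zero] at this
  exact hy.injective this

section Periodic

variable {n : ℕ}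

theorem ghost_period (hy : IsRingLift n y) (hv : ∀ k, v (k + n) = v k) (k : ℤ) (t : ℝ) :
    ghost y v (k + n) t = ghost y v k t + 1 := by
  unfold ghost; rw [hy.period, hv]; ring

theorem ghostSwap_period (hy : IsRingLift n y) (hv : ∀ k, v (k + n) = v k) (t : ℝ) (k : ℤ) :
    ghostSwap hy.mono v t (k + n) = ghostSwap hy.mono v t k + n := by
  by_cases h : ghostSwap hy.mono v t k = k
  · rw [h]
    by_contra h2
    apply h2
    have h3 := ghost_ghostSwap (v := v) hy.mono t (k + n)
    set j := ghostSwap hy.mono v t (k + n)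
    exfalso
    have h4 : ghost y v (j - n) t = ghost y v k t := by
      have := ghost_period hy hv (j - n) t
      rw [ghost_period hy hv k t] at h3
      rw [sub_add_cancel] at this
      linarith
    have := ghostSwap_eq hy.mono (fun h5 => h2 (by linarith)) h4
    exact h2 (by linarith)
  · apply ghostSwap_eq
    · exact fun h2 => h (by linarith)
    · rw [ghost_period hy hv, ghost_period hy hv, ghost_ghostSwap]

/-- In unit time a ghost makes one full turn, which is `n` places in the numbering. -/
theorem ghost_one (hy : IsRingLift n y) (k : ℤ) : ghost y v k 1 = y (k + n * (v k : ℤˣ)) := by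
  rw [hy.add_mul]; simp [ghost]

theorem velocity_add_mul (hv : ∀ k, v (k + n) = v k) (k m : ℤ) : v (k + n * m) = v k := by
  have := map_add_mul_of_period (f := fun k => Additive.ofMul (v k)) (c := 0)
    (by simpa using hv) k m
  simpa using this

/-- The times of the meetings of ghosts during a round. -/
def meetingTimes (hy : StrictMono y) (v : ℤ → ℤˣ) : Set ℝ :=
  {t | t ∈ Ioo (0 : ℝ) 1 ∧ ghostSwap hy v t ≠ 1}

/-- By periodicity one of the two ghosts has its number in `[0, n)`. They approach at relative speed
two, so they start less than two turns apart, which leaves finitely many partners; the pair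
determines the time. -/
theorem meetingTimes_finite [NeZero n] (hy : IsRingLift n y) (hv : ∀ k, v (k + n) = v k) :
    (meetingTimes hy.mono v).Finite := by
  have key : meetingTimes hy.mono v ⊆
      (fun q : Fin n × ℤ => |y q.2 - y ((q.1 : ℕ) : ℤ)| / 2) ''
        (Set.univ ×ˢ Set.Icc (-(2 * n : ℤ)) (3 * n)) := by
    rintro t ⟨⟨h0, h1⟩, ht⟩
    obtain ⟨k, hk⟩ : ∃ k, ghostSwap hy.mono v t k ≠ k := by
      by_contra! h; exact ht (Equiv.ext h)
    have hper : ∀ m : ℤ, ghostSwap hy.mono v t (k + n * m) = ghostSwap hy.mono v t k + n * m :=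
      fun m => by rw [map_add_mul_of_period (ghostSwap_period hy hv t), smul_eq_mul, mul_comm m]
    obtain ⟨m, hm⟩ := agentAt_eq_add_mul (n := n)
      (show agentAt n ((agentAt n k : ℕ) : ℤ) = agentAt n k by simp)
    set i := agentAt n k
    have hi : ghostSwap hy.mono v t (i : ℕ) ≠ (i : ℕ) := by
      rw [hm, hper]; exact fun h => hk (by linarith)
    set j := ghostSwap hy.mono v t (i : ℕ) with hj
    have hg := ghost_ghostSwap (v := v) hy.mono t (i : ℕ)
    have hvj := velocity_ghostSwap hy.mono hi
    rw [← hj] at hg hvj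
    have habs : |y j - y ((i : ℕ) : ℤ)| = 2 * t := by
      unfold ghost at hg
      rw [hvj] at hg
      rcases Int.units_eq_one_or (v ((i : ℕ) : ℤ)) with h | h <;> rw [h] at hg <;>
        push_cast at hg
      · rw [show y j - y ((i : ℕ) : ℤ) = 2 * t by linarith]; exact abs_of_pos (by linarith)
      · rw [show y j - y ((i : ℕ) : ℤ) = -(2 * t) by linarith, abs_neg]
        exact abs_of_pos (by linarith)
    refine ⟨(i, j), ⟨mem_univ _, ?_⟩, by simp only [habs]; ring⟩
    have hi2 : ((i : ℕ) : ℤ) < n := by exact_mod_cast i.2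
    have hi3 : (0 : ℤ) ≤ ((i : ℕ) : ℤ) := by positivity
    obtain ⟨hl, hr⟩ := abs_lt.1 (show |y j - y ((i : ℕ) : ℤ)| < 2 by rw [habs]; linarith)
    have e1 := hy.add_mul (i : ℕ) 2
    have e2 := hy.add_mul (i : ℕ) (-2)
    push_cast at e1 e2
    have l1 : j < (i : ℕ) + n * 2 := hy.mono.lt_iff_lt.1 (by linarith)
    have l2 : ((i : ℕ) : ℤ) + n * (-2) < j := hy.mono.lt_iff_lt.1 (by linarith)
    constructor <;> simp only <;> linarith
  exact ((finite_univ.prod (finite_Icc _ _)).image _).subset key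

end Periodic

/-! ### Chronological products -/

/-- The product of the factors `f e` over the times `e ∈ E` with `e < t`, later factors first. -/
def chronProd {G : Type*} [Monoid G] (E : Finset ℝ) (f : ℝ → G) (t : ℝ) : G :=
  (((E.filter (· < t)).sort (· ≥ ·)).map f).prod

section ChronProd

variable {G : Type*} [Monoid G] {E : Finset ℝ} {f : ℝ → G}

theorem chronProd_induction (C : G → Prop) (h1 : C 1) (t : ℝ)
    (hmul : ∀ e ∈ E, e < t → ∀ g, C g → C (f e * g)) : C (chronProd E f t) := by
  unfold chronProd
  have h2 : ∀ l : List ℝ, (∀ e ∈ l, e ∈ E ∧ e < t) → C ((l.map f).prod) := by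
    intro l
    induction l with
    | nil => intro _; simpa using h1
    | cons a l ih =>
      intro hl
      rw [List.map_cons, List.prod_cons]
      exact hmul a (hl a (by simp)).1 (hl a (by simp)).2 _
        (ih fun e he => hl e (List.mem_cons_of_mem _ he))
  exact h2 _ fun e he => by simpa using he

/-- The inequality `e < t` in the product is strict. Its value at `t` therefore describes the
arrival at `t`, and the factor of `t` itself acts only afterwards. -/
theorem chronProd_eventually_left (t : ℝ) :
    ∀ᶠ s in 𝓝[<] t, chronProd E f s = chronProd E f t := by
  have : ∀ᶠ s in 𝓝[<] t, ∀ e ∈ E, e < t → e < s := by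
    rw [Filter.eventually_all_finset]
    intro e _
    by_cases h : e < t
    · filter_upwards [mem_nhdsWithin_of_mem_nhds (Ioi_mem_nhds h)] with s hs _ using hs
    · exact Eventually.of_forall fun s hs => absurd hs h
  filter_upwards [this, self_mem_nhdsWithin] with s hs hst
  unfold chronProd
  congr 3
  ext e
  simp only [Finset.mem_filter, and_congr_right_iff]
  exact fun he => ⟨fun h => h.trans hst, hs e he⟩

theorem chronProd_eventually_right (t : ℝ) (ht : t ∉ E → f t = 1) :
    ∀ᶠ s in 𝓝[>] t, chronProd E f s = f t * chronProd E f t := by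
  have : ∀ᶠ s in 𝓝[>] t, ∀ e ∈ E, t < e → s < e := by
    rw [Filter.eventually_all_finset]
    intro e _
    by_cases h : t < e
    · filter_upwards [mem_nhdsWithin_of_mem_nhds (Iio_mem_nhds h)] with s hs _ using hs
    · exact Eventually.of_forall fun s hs => absurd hs h
  filter_upwards [this, self_mem_nhdsWithin] with s hs hst
  have hst : t < s := hst
  by_cases h : t ∈ E
  · have h1 : E.filter (· < s) = insert t (E.filter (· < t)) := by
      ext e
      simp only [Finset.mem_filter, Finset.mem_insert]
      constructor
      · rintro ⟨he, hes⟩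
        rcases lt_trichotomy e t with h2 | h2 | h2
        · exact Or.inr ⟨he, h2⟩
        · exact Or.inl h2
        · exact absurd (hs e he h2) (by linarith)
      · rintro (rfl | ⟨he, h2⟩)
        · exact ⟨h, hst⟩
        · exact ⟨he, h2.trans hst⟩
    unfold chronProd
    rw [h1, Finset.sort_insert (r := (· ≥ ·)) (fun b hb => (Finset.mem_filter.1 hb).2.le) (by simp)]
    simp
  · rw [ht h, one_mul]
    unfold chronProd
    congr 3
    ext e
    simp only [Finset.mem_filter, and_congr_right_iff]
    intro he
    constructor
    · intro hes
      rcases lt_trichotomy e t with h2 | h2 | h2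
      · exact h2
      · exact absurd (h2 ▸ he) h
      · exact absurd (hs e he h2) (by linarith)
    · exact fun h2 => h2.trans hst

end ChronProd

end

/-- Induction on the points of the unit interval, from left to right. -/
theorem Icc_induction {P : ℝ → Prop}
    (h : ∀ t ∈ Icc (0 : ℝ) 1, (∀ s ∈ Ico (0 : ℝ) t, P s) →
      P t ∧ (t < 1 → ∀ᶠ s in 𝓝[>] t, P s)) :
    ∀ t ∈ Icc (0 : ℝ) 1, P t := by
  by_contra! hcon
  obtain ⟨t₀, ht₀, hP₀⟩ := hcon
  -- At the infimum of the failures `P` holds, and it holds on an interval to the right of it, so no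
  -- failure can be close to the infimum.
  let B : Set ℝ := {t | t ∈ Icc (0 : ℝ) 1 ∧ ¬ P t}
  have hB : t₀ ∈ B := ⟨ht₀, hP₀⟩
  have hbdd : BddBelow B := ⟨0, fun t ht => ht.1.1⟩
  have hs0 : 0 ≤ sInf B := le_csInf ⟨t₀, hB⟩ fun t ht => ht.1.1
  have hs1 : sInf B ≤ t₀ := csInf_le hbdd hB
  have hlt : ∀ s ∈ Ico (0 : ℝ) (sInf B), P s := by
    intro s hs
    by_contra hPs
    exact absurd (csInf_le hbdd ⟨⟨hs.1, by linarith [hs.2, ht₀.2]⟩, hPs⟩) (not_le.2 hs.2)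
  obtain ⟨hP, hr⟩ := h (sInf B) ⟨hs0, hs1.trans ht₀.2⟩ hlt
  have hne : sInf B ≠ t₀ := fun he => hP₀ (he ▸ hP)
  obtain ⟨u, hu, hu2⟩ := mem_nhdsGT_iff_exists_Ioo_subset.1
    (hr (lt_of_lt_of_le (lt_of_le_of_ne hs1 hne) ht₀.2))
  obtain ⟨b, hb, hbu⟩ := exists_lt_of_csInf_lt ⟨t₀, hB⟩ hu
  rcases (csInf_le hbdd hb).eq_or_lt with h2 | h2
  · exact hb.2 (h2 ▸ hP)
  · exact hb.2 (hu2 ⟨h2, hbu⟩)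

theorem unitAddCircle_coe_eq_iff {a b : ℝ} :
    ((a : UnitAddCircle) = b) ↔ ∃ m : ℤ, a = b + m := by
  rw [← sub_eq_zero, ← AddCircle.coe_sub, AddCircle.coe_eq_zero_iff]
  refine exists_congr fun m => ?_
  simp only [zsmul_eq_mul, mul_one]
  constructor <;> intro h <;> linarith

/-! ### Trajectories of the bouncing agents and their total shift in a round -/

noncomputable section

variable {n : ℕ} [NeZero n] {y : ℤ → ℝ} {v : ℤ → ℤˣ}

/-- The number of the ghost that coincides with agent `k` until time `t`. -/
def bounceIndex (hy : IsRingLift n y) (hv : ∀ k, v (k + n) = v k) (t : ℝ) : Equiv.Perm ℤ :=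
  chronProd (meetingTimes_finite hy hv).toFinset (ghostSwap hy.mono v) t

/-- The position of agent `k` at time `t`, lifted to the line. -/
def track (hy : IsRingLift n y) (hv : ∀ k, v (k + n) = v k) (k : ℤ) (t : ℝ) : ℝ :=
  ghost y v (bounceIndex hy hv t k) t

variable (hy : IsRingLift n y) (hv : ∀ k, v (k + n) = v k)

theorem bounceIndex_period (t : ℝ) (k : ℤ) :
    bounceIndex hy hv t (k + n) = bounceIndex hy hv t k + n := by
  refine chronProd_induction (C := fun g : Equiv.Perm ℤ => ∀ k, g (k + n) = g k + n)
    (fun _ => rfl) t (fun e _ _ g hg k => ?_) k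
  rw [Equiv.Perm.mul_apply, hg, ghostSwap_period hy hv]; rfl

theorem track_period (t : ℝ) (k : ℤ) : track hy hv (k + n) t = track hy hv k t + 1 := by
  unfold track
  rw [bounceIndex_period, ghost_period hy hv]

theorem track_add_mul (t : ℝ) (k m : ℤ) : track hy hv (k + n * m) t = track hy hv k t + m := by
  simpa using map_add_mul_of_period (f := fun k => track hy hv k t) (track_period hy hv t) k m

/-- The swap is a periodic involution: reindexing the sum by it changes the sign of every summand.
-/
theorem sum_ghostSwap_sub (hy : IsRingLift n y) (hv : ∀ k, v (k + n) = v k) (t : ℝ) :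
    ∑ i : Fin n, (ghostSwap hy.mono v t (i : ℕ) - ((i : ℕ) : ℤ)) = 0 := by
  have h := sum_periodic_comp_perm (n := n) (fun k => ghostSwap hy.mono v t k - k)
    (fun k => by rw [ghostSwap_period hy hv]; ring) (ghostSwap hy.mono v t)
    (ghostSwap_period hy hv t)
  have h2 : ∀ k, ghostSwap hy.mono v t (ghostSwap hy.mono v t k) = k :=
    fun k => Equiv.ext_iff.1 (ghostSwap_mul_self hy.mono t) k
  simp only [h2] at h
  rw [← Finset.sum_congr rfl (fun i _ => neg_sub _ _), Finset.sum_neg_distrib] at h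
  linarith

/-- Total displacements over a period add up when periodic permutations are composed, and each swap
contributes zero. -/
theorem sum_bounceIndex_sub (t : ℝ) :
    ∑ i : Fin n, (bounceIndex hy hv t (i : ℕ) - ((i : ℕ) : ℤ)) = 0 := by
  refine (chronProd_induction (C := fun g : Equiv.Perm ℤ => (∀ k, g (k + n) = g k + n) ∧
    ∑ i : Fin n, (g (i : ℕ) - ((i : ℕ) : ℤ)) = 0) ⟨fun _ => rfl, by simp⟩ t
    (fun e _ _ g hg => ⟨fun k => ?_, ?_⟩)).2
  · rw [Equiv.Perm.mul_apply, hg.1, ghostSwap_period hy hv]; rfl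
  · have h := sum_periodic_comp_perm (n := n) (fun k => ghostSwap hy.mono v e k - k)
      (fun k => by rw [ghostSwap_period hy hv]; ring) g hg.1
    rw [sum_ghostSwap_sub hy hv] at h
    have h2 := congrArg₂ (· + ·) h hg.2
    simp only [← Finset.sum_add_distrib, sub_add_sub_cancel, add_zero] at h2
    exact h2

theorem sum_velocity_bounceIndex (t : ℝ) :
    ∑ i : Fin n, ((v (bounceIndex hy hv t (i : ℕ)) : ℤˣ) : ℤ) =
      ∑ i : Fin n, ((v (i : ℕ) : ℤˣ) : ℤ) :=
  sum_periodic_comp_perm (fun k => ((v k : ℤˣ) : ℤ)) (fun k => by rw [hv]) _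
    (bounceIndex_period hy hv t)

theorem bounceIndex_zero : bounceIndex hy hv 0 = 1 := by
  refine chronProd_induction (C := fun g : Equiv.Perm ℤ => g = 1) rfl 0 fun e he h => ?_
  have := ((Set.Finite.mem_toFinset _).1 he).1.1
  linarith

theorem bounceIndex_eq_self {t : ℝ} {k : ℤ}
    (h : ∀ e ∈ Ioo (0 : ℝ) 1, e < t → ghostSwap hy.mono v e k = k) :
    bounceIndex hy hv t k = k := by
  refine chronProd_induction (C := fun g : Equiv.Perm ℤ => g k = k) rfl t fun e he het g hg => ?_
  rw [Equiv.Perm.mul_apply, hg, h e ((Set.Finite.mem_toFinset _).1 he).1 het]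

theorem track_zero (k : ℤ) : track hy hv k 0 = y k := by
  simp [track, bounceIndex_zero, ghost]

theorem track_eventually_left (t : ℝ) :
    ∀ᶠ s in 𝓝[<] t, ∀ k, track hy hv k s = ghost y v (bounceIndex hy hv t k) s := by
  filter_upwards [chronProd_eventually_left (E := (meetingTimes_finite hy hv).toFinset)
    (f := ghostSwap hy.mono v) t] with s hs k
  unfold track bounceIndex
  rw [hs]

theorem track_eventually_right {t : ℝ} (ht : t ∈ Ico (0 : ℝ) 1) :
    ∀ᶠ s in 𝓝[>] t, ∀ k, track hy hv k s =
      ghost y v (ghostSwap hy.mono v t (bounceIndex hy hv t k)) s := by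
  filter_upwards [chronProd_eventually_right (E := (meetingTimes_finite hy hv).toFinset)
    (f := ghostSwap hy.mono v) t (fun h => by
      by_contra h2
      rcases ht.1.eq_or_lt with h3 | h3
      · exact h2 (h3 ▸ ghostSwap_zero hy.mono)
      · exact h ((Set.Finite.mem_toFinset _).2 ⟨⟨h3, ht.2⟩, h2⟩))] with s hs k
  unfold track bounceIndex
  rw [hs]; rfl

theorem continuous_ghost (k : ℤ) : Continuous (ghost y v k) := by
  unfold ghost; fun_prop

/-- Agents do not overtake each other. The order passes to the limit from the left; a strict
inequality persists to the right by continuity, and at an equality the swap keeps the order. -/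
theorem track_le_succ (k : ℤ) : ∀ t ∈ Icc (0 : ℝ) 1, track hy hv k t ≤ track hy hv (k + 1) t := by
  refine Icc_induction fun t ht hlt => ?_
  set π := bounceIndex hy hv t with hπ
  have hleft : 0 < t → ∃ s < t, ghost y v (π k) s ≤ ghost y v (π (k + 1)) s := by
    intro h0
    obtain ⟨s, h1, h2, h3⟩ := ((track_eventually_left hy hv t).and
      ((Ioo_mem_nhdsLT h0 : ∀ᶠ s in 𝓝[<] t, s ∈ Ioo 0 t))).exists.imp
        fun s hs => (⟨hs.1, hs.2.1, hs.2.2⟩ : _ ∧ _ ∧ _)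
    have := hlt s ⟨h2.le, h3⟩
    rw [h1, h1] at this
    exact ⟨s, h3, this⟩
  have hle : track hy hv k t ≤ track hy hv (k + 1) t := by
    rcases ht.1.eq_or_lt with h0 | h0
    · rw [← h0, track_zero, track_zero]; exact (hy.mono (by linarith)).le
    · have : ∀ᶠ s in 𝓝[<] t, ghost y v (π k) s ≤ ghost y v (π (k + 1)) s := by
        filter_upwards [track_eventually_left hy hv t, Ioo_mem_nhdsLT h0] with s h1 h2
        have := hlt s ⟨h2.1.le, h2.2⟩
        rwa [h1, h1] at this
      exact le_of_tendsto_of_tendsto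
        ((continuous_ghost _).continuousAt.tendsto.mono_left nhdsWithin_le_nhds)
        ((continuous_ghost _).continuousAt.tendsto.mono_left nhdsWithin_le_nhds) this
  refine ⟨hle, fun h1 => ?_⟩
  have hright := track_eventually_right hy hv ⟨ht.1, h1⟩
  rcases hle.eq_or_lt with heq | hlt2
  · have hne : π k ≠ π (k + 1) := fun h => by simpa using π.injective h
    have hne0 : 0 < t := by
      refine ht.1.lt_of_ne fun h0 => ?_
      rw [← h0, track_zero, track_zero] at heq
      exact absurd heq (hy.mono (by linarith)).ne
    obtain ⟨s', hs', hle'⟩ := hleft hne0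
    have e1 := ghostSwap_eq hy.mono hne heq
    have e2 := ghostSwap_eq hy.mono hne.symm heq.symm
    filter_upwards [hright, self_mem_nhdsWithin] with s hs hst
    rw [hs, hs, e1, e2]
    have hst : t < s := hst
    have heq : ghost y v (π k) t = ghost y v (π (k + 1)) t := heq
    rw [ghost_sub (π (k + 1)) s t, ghost_sub (π k) s t, heq]
    rw [ghost_sub (π (k + 1)) s' t, ghost_sub (π k) s' t, heq] at hle'
    -- Ghost `π k` was not ahead at `s' < t` and has caught up at `t`, so it is at least as fast;
    -- after the swap it carries the front agent `k + 1`.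
    have : (((v (π (k + 1)) : ℤˣ) : ℤ) : ℝ) ≤ ((v (π k) : ℤˣ) : ℤ) := by nlinarith
    nlinarith
  · have hc : ∀ k, Tendsto (ghost y v (ghostSwap hy.mono v t (π k))) (𝓝[>] t)
        (𝓝 (track hy hv k t)) := fun k => by
      have := (continuous_ghost (y := y) (v := v) (ghostSwap hy.mono v t (π k))).continuousAt
        (x := t)
      rw [ContinuousAt, ghost_ghostSwap] at this
      exact this.mono_left nhdsWithin_le_nhds
    filter_upwards [hright, (hc k).eventually_lt (hc (k + 1)) hlt2] with s h1 h2
    rw [h1, h1]; exact h2.le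

omit [NeZero n] in
-- Equal end numbers are congruent start numbers modulo `n`, hence equal velocities. So ghosts are
-- at distinct points at the end of the round too.
theorem endIndex_injective (hv : ∀ k, v (k + n) = v k) :
    Function.Injective (fun k : ℤ => k + n * ((v k : ℤˣ) : ℤ)) := by
  intro j k h
  simp only at h
  have : v j = v k := by
    rw [show j = k + n * (((v k : ℤˣ) : ℤ) - ((v j : ℤˣ) : ℤ)) by linarith]
    exact velocity_add_mul hv _ _
  rw [this] at h
  linarith

omit [NeZero n] in
theorem ghostSwap_one (hy : IsRingLift n y) (hv : ∀ k, v (k + n) = v k) :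
    ghostSwap hy.mono v 1 = 1 := by
  ext k
  have := ghost_ghostSwap (v := v) hy.mono 1 k
  rw [ghost_one hy, ghost_one hy] at this
  exact endIndex_injective hv (hy.mono.injective this)

theorem int_shift_of_strictMono_surjective {φ : ℤ → ℤ} (hm : StrictMono φ)
    (hs : Function.Surjective φ) (k : ℤ) : φ k = k + φ 0 := by
  have h : ∀ k, φ (k + 1) = φ k + 1 := fun k => by
    simpa [Order.succ_eq_add_one] using (hm.orderIsoOfSurjective φ hs).map_succ k
  have := map_add_mul_of_period (n := 1) (f := φ) (c := 1) (by simpa using h) 0 k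
  simp at this
  linarith

/-- Each agent moves by as many places as the sum of the initial velocities says. -/
theorem track_one (k : ℤ) :
    track hy hv k 1 = y (k + ∑ i : Fin n, ((v (i : ℕ) : ℤˣ) : ℤ)) := by
  set π := bounceIndex hy hv 1 with hπ
  let φ : ℤ → ℤ := fun k => π k + n * ((v (π k) : ℤˣ) : ℤ)
  have hφ : ∀ k, track hy hv k 1 = y (φ k) := fun k => ghost_one hy _
  have hmono : StrictMono φ := by
    refine strictMono_int_of_lt_succ fun k => ?_
    refine lt_of_le_of_ne ?_ fun h => ?_
    · rw [← hy.mono.le_iff_le, ← hφ, ← hφ]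
      exact track_le_succ hy hv k 1 (by simp)
    · simpa using π.injective (endIndex_injective hv h)
  have hsurj : Function.Surjective φ := by
    intro j
    refine ⟨π.symm (j - n * ((v j : ℤˣ) : ℤ)), ?_⟩
    simp only [φ, Equiv.apply_symm_apply]
    have : v (j - n * ((v j : ℤˣ) : ℤ)) = v j := by
      rw [show j - n * ((v j : ℤˣ) : ℤ) = j + n * (-((v j : ℤˣ) : ℤ)) by ring]
      exact velocity_add_mul hv _ _
    rw [this]; ring
  have hshift := int_shift_of_strictMono_surjective hmono hsurj
  -- The swaps have no net effect and the full turns contribute `n` times the velocities. As `φ` is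
  -- a shift, the left side is also `n * φ 0`.
  have hsum : ∑ i : Fin n, (φ (i : ℕ) - ((i : ℕ) : ℤ)) =
      n * ∑ i : Fin n, ((v (i : ℕ) : ℤˣ) : ℤ) := by
    have h := sum_bounceIndex_sub hy hv 1
    rw [← sum_velocity_bounceIndex hy hv 1, Finset.mul_sum]
    simp only [φ, add_sub_right_comm, Finset.sum_add_distrib]
    rw [← hπ] at h ⊢
    rw [h, zero_add]
  have h0 : φ 0 = ∑ i : Fin n, ((v (i : ℕ) : ℤˣ) : ℤ) := by
    rw [Finset.sum_congr rfl fun (i : Fin n) _ =>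
      show φ (i : ℕ) - ((i : ℕ) : ℤ) = φ 0 by rw [hshift]; ring] at hsum
    simp only [Finset.sum_const, Finset.card_univ, Fintype.card_fin, nsmul_eq_mul] at hsum
    have hn := (intCast_pos_of_neZero (n := n)).ne'
    exact mul_left_cancel₀ hn hsum
  rw [hφ, hshift, h0]

/-! ### The motion of the agents -/

/-- The position of agent `i` at time `t`. -/
def ringMotion (i : Fin n) (t : ℝ) : UnitAddCircle := (track hy hv (i : ℕ) t : ℝ)

theorem ringMotion_agentAt (k : ℤ) (t : ℝ) :
    ringMotion hy hv (agentAt n k) t = (track hy hv k t : ℝ) := by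
  obtain ⟨m, hm⟩ := agentAt_eq_add_mul (n := n)
    (show agentAt n ((agentAt n k : ℕ) : ℤ) = agentAt n k by simp)
  exact unitAddCircle_coe_eq_iff.2 ⟨m, by rw [← track_add_mul, ← hm]⟩

/-- Points that agree on the circle have lifts that differ by whole turns, so changing the number of
one agent by a multiple of `n` turns the collision into a meeting of ghosts on the line. -/
theorem meets_ringMotion_iff (i : Fin n) (t : ℝ) :
    Meets (ringMotion hy hv) i t ↔
      ghostSwap hy.mono v t (bounceIndex hy hv t (i : ℕ)) ≠ bounceIndex hy hv t (i : ℕ) := by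
  set π := bounceIndex hy hv t with hπ
  constructor
  · rintro ⟨j, hj, h⟩
    obtain ⟨m, hm⟩ := unitAddCircle_coe_eq_iff.1 h
    have h2 : track hy hv ((j : ℕ) + n * (-m)) t = track hy hv (i : ℕ) t := by
      rw [track_add_mul, hm]; push_cast; ring
    have h3 : π ((j : ℕ) + n * (-m)) ≠ π (i : ℕ) := fun h4 => hj (by
      have := congrArg (agentAt n) (π.injective h4)
      rwa [agentAt_add_mul, agentAt_natCast, agentAt_natCast] at this)
    rw [ghostSwap_eq hy.mono h3 h2]
    exact h3
  · intro h
    set l := ghostSwap hy.mono v t (π (i : ℕ)) with hl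
    have h2 : track hy hv (π.symm l) t = track hy hv (i : ℕ) t := by
      unfold track
      rw [← hπ, Equiv.apply_symm_apply, hl, ghost_ghostSwap]
    refine ⟨agentAt n (π.symm l), fun h3 => ?_, ?_⟩
    -- The partner is not another lift of agent `i`: distinct lifts of one agent are a nonzero
    -- integer apart.
    · rw [← agentAt_natCast i] at h3
      obtain ⟨m, hm⟩ := agentAt_eq_add_mul h3
      rw [hm, track_add_mul] at h2
      have hm0 : m = 0 := by exact_mod_cast (by linarith : (m : ℝ) = 0)
      rw [hm0, mul_zero, add_zero, Equiv.symm_apply_eq] at hm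
      exact h hm
    · rw [ringMotion_agentAt, h2]; rfl

theorem isMotion_ringMotion :
    IsMotion (fun i => (y (i : ℕ) : UnitAddCircle)) (fun i => ((v (i : ℕ) : ℤ) : ℝ))
      (ringMotion hy hv) (fun i t => ((v (bounceIndex hy hv t (i : ℕ)) : ℤ) : ℝ))
      (fun i t => ((v (ghostSwap hy.mono v t (bounceIndex hy hv t (i : ℕ))) : ℤ) : ℝ)) where
  start i := by rw [ringMotion, track_zero]
  launch i := by rw [ghostSwap_zero, bounceIndex_zero]; rfl
  leave i t ht := by
    filter_upwards [track_eventually_right hy hv ht] with s hs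
    rw [ringMotion, hs, ghost_sub _ s t, ghost_ghostSwap, AddCircle.coe_add]; rfl
  arrive i t _ := by
    filter_upwards [track_eventually_left hy hv t] with s hs
    rw [ringMotion, ringMotion, hs, ← AddCircle.coe_add, ← ghost_sub]; rfl
  bounce i t _ h := by
    rw [velocity_ghostSwap hy.mono ((meets_ringMotion_iff hy hv i t).1 h)]; simp
  keep i t _ h := by
    rw [meets_ringMotion_iff, not_not] at h
    rw [h]

/-! ### The first collision -/

/-- The times at which ghost `k` meets another one during a round. -/
def ghostMeetings (hy : StrictMono y) (v : ℤ → ℤˣ) (k : ℤ) : Set ℝ :=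
  {t | t ∈ Ioo (0 : ℝ) 1 ∧ ghostSwap hy v t k ≠ k}


theorem mem_ghostMeetings_iff {k : ℤ} {t : ℝ} (hy : StrictMono y) (ht : t ∈ Ioo (0 : ℝ) 1) :
    t ∈ ghostMeetings hy v k ↔ ∃ j, v j ≠ v k ∧ y j - y k = 2 * (((v k : ℤ) : ℝ) * t) := by
  constructor
  · rintro ⟨_, h⟩
    have h1 := ghost_ghostSwap (v := v) hy t k
    have h2 := velocity_ghostSwap hy h
    refine ⟨ghostSwap hy v t k, ?_, ?_⟩
    · rw [h2]; exact units_ne_neg_self _ |>.symm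
    · unfold ghost at h1
      rw [h2] at h1
      push_cast at h1
      linarith
  · rintro ⟨j, hj, h⟩
    have hjk : j ≠ k := fun h2 => hj (h2 ▸ rfl)
    refine ⟨ht, ?_⟩
    rw [ghostSwap_eq hy hjk]
    · exact hjk
    · unfold ghost
      rw [units_eq_neg_of_ne hj]
      push_cast
      linarith

omit [NeZero n] in
-- Replacing the partner by its lift one turn closer shortens the time by `1 / 2`. A first collision
-- thus occurs within path length `1 / 2`, where path length and distance on the circle agree.
theorem exists_ghostMeetings_le_half (hy : IsRingLift n y) (hv : ∀ k, v (k + n) = v k) {k : ℤ}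
    {t : ℝ} (h : t ∈ ghostMeetings hy.mono v k) :
    ∃ s ∈ ghostMeetings hy.mono v k, s ≤ 1 / 2 := by
  by_cases hlt : t ≤ 1 / 2
  · exact ⟨t, h, hlt⟩
  · have ht := h.1
    obtain ⟨j, hj, hd⟩ := (mem_ghostMeetings_iff hy.mono ht).1 h
    refine ⟨t - 1 / 2, (mem_ghostMeetings_iff hy.mono ⟨by linarith, by linarith [ht.2]⟩).2
      ⟨j + n * (-((v k : ℤˣ) : ℤ)), ?_, ?_⟩, by linarith [ht.2]⟩
    · rwa [velocity_add_mul hv]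
    · rw [hy.add_mul]; push_cast; linarith

/-- The first collision of agent `i` is the first meeting of ghost `i`. -/
theorem exists_isColl_ringMotion (i : Fin n) :
    ∃ o : Option ℝ, IsColl (ringMotion hy hv) i o ∧
      (o = none → ghostMeetings hy.mono v (i : ℕ) = ∅) ∧
      ∀ c, o = some c → IsLeast (ghostMeetings hy.mono v (i : ℕ)) c := by
  -- Up to and including its first meeting, ghost `i` still carries agent `i`.
  have hmeet : ∀ t ∈ Icc (0 : ℝ) 1, (∀ s ∈ ghostMeetings hy.mono v (i : ℕ), t ≤ s) →
      bounceIndex hy hv t (i : ℕ) = (i : ℕ) ∧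
      (Meets (ringMotion hy hv) i t ↔ t ∈ ghostMeetings hy.mono v (i : ℕ)) := by
    intro t ht hmin
    have hπ : bounceIndex hy hv t (i : ℕ) = (i : ℕ) := by
      refine bounceIndex_eq_self hy hv fun e he het => ?_
      by_contra h
      exact absurd (hmin e ⟨he, h⟩) (not_le.2 het)
    refine ⟨hπ, ?_⟩
    rw [meets_ringMotion_iff, hπ]
    refine ⟨fun h => ⟨⟨ht.1.lt_of_ne fun h0 => ?_, ht.2.lt_of_ne fun h0 => ?_⟩, h⟩, fun h => h.2⟩
    · rw [← h0, ghostSwap_zero] at h; exact h rfl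
    · rw [h0, ghostSwap_one hy hv] at h; exact h rfl
  rcases (ghostMeetings hy.mono v (i : ℕ)).eq_empty_or_nonempty with he | hne
  · refine ⟨none, fun t ht => ?_, fun _ => he, fun c h => by simp at h⟩
    rw [(hmeet t ht (by simp [he])).2, he]
    simp
  · have hfin : (ghostMeetings hy.mono v (i : ℕ)).Finite :=
      (meetingTimes_finite hy hv).subset fun t ht => ⟨ht.1, fun h => ht.2 (by rw [h]; rfl)⟩
    obtain ⟨c, hc, hmin⟩ := Set.exists_min_image _ id hfin hne
    simp only [id] at hmin
    have hcI : c ∈ Icc (0 : ℝ) 1 := ⟨hc.1.1.le, hc.1.2.le⟩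
    refine ⟨some c, ⟨c, hcI, ?_, ?_, ?_⟩, by simp, ?_⟩
    · exact (hmeet c hcI hmin).2.2 hc
    · intro s hs
      rw [(hmeet s ⟨hs.1, by linarith [hs.2, hc.1.2]⟩ fun t ht => hs.2.le.trans (hmin t ht)).2]
      exact fun h => absurd (hmin s h) (not_le.2 hs.2)
    · obtain ⟨s, hs, hs2⟩ := exists_ghostMeetings_le_half hy hv hc
      have hc2 : c ≤ 1 / 2 := (hmin s hs).trans hs2
      have hcabs : |((v (i : ℕ) : ℤ) : ℝ) * c| = c := by
        rcases Int.units_eq_one_or (v (i : ℕ)) with h | h <;> rw [h] <;>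
          simp [abs_of_pos hc.1.1]
      rw [ringMotion, ringMotion, track_zero, track, (hmeet c hcI hmin).1, ghost,
        AddCircle.coe_add, dist_self_add_right, (AddCircle.norm_coe_eq_abs_iff _ one_ne_zero).2,
        hcabs]
      rw [hcabs]; simpa using hc2
    · rintro c' ⟨rfl⟩
      exact ⟨hc, hmin⟩

/-- The distance between the agents `k` and `k ± 1`. -/
def neighborGap (y : ℤ → ℝ) (k : ℤ) (ε : ℤˣ) : ℝ := |y (k + (ε : ℤ)) - y k|


theorem neighborGap_eq (hy : StrictMono y) (k : ℤ) (ε : ℤˣ) :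
    y (k + (ε : ℤ)) - y k = ((ε : ℤ) : ℝ) * neighborGap y k ε := by
  unfold neighborGap
  rcases Int.units_eq_one_or ε with rfl | rfl
  · have := hy (show k < k + 1 by linarith)
    simp only [Units.val_one, Int.cast_one, one_mul]
    rw [abs_of_pos (by linarith)]
  · have := hy (show k + -1 < k by linarith)
    simp only [Units.val_neg, Units.val_one, Int.cast_neg, Int.cast_one]
    rw [abs_of_neg (by linarith)]; ring

theorem neighborGap_half_mem (k : ℤ) {ε : ℤˣ} (hk : v k = ε) (h : v (k + (ε : ℤ)) ≠ ε) :
    neighborGap y k ε / 2 ∈ ghostMeetings hy.mono v k := by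
  have hn := intCast_pos_of_neZero (n := n)
  have h1 : 0 < neighborGap y k ε := abs_pos.2 (sub_ne_zero.2 fun h2 => by
    simpa using hy.mono.injective h2)
  have h2 : neighborGap y k ε ≤ 1 := by
    have e1 := hy.period k
    have e2 := hy.period (k - n)
    rw [sub_add_cancel] at e2
    have l1 := hy.mono.monotone (show k + 1 ≤ k + n by linarith)
    have l2 := hy.mono.monotone (show k - n ≤ k + -1 by linarith)
    have m1 := hy.mono (show k < k + 1 by linarith)
    have m2 := hy.mono (show k + -1 < k by linarith)
    rw [neighborGap, abs_le]
    rcases Int.units_eq_one_or ε with rfl | rfl <;>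
      simp only [Units.val_one, Units.val_neg] <;> constructor <;> linarith
  rw [mem_ghostMeetings_iff hy.mono ⟨by linarith, by linarith⟩]
  exact ⟨k + (ε : ℤ), by rwa [hk], by rw [neighborGap_eq hy.mono, hk]; ring⟩


/-- A ghost that is met starts ahead on side `ε`, hence no closer than the neighbour there; equality
would make it the neighbour itself, which must then approach. -/
theorem neighborGap_half_le (hy : StrictMono y) {k : ℤ} {ε : ℤˣ} (hk : v k = ε) {t : ℝ}
    (ht : t ∈ ghostMeetings hy v k) :
    neighborGap y k ε / 2 ≤ t ∧ (v (k + (ε : ℤ)) = ε → t ≠ neighborGap y k ε / 2) := by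
  obtain ⟨j, hj, hd⟩ := (mem_ghostMeetings_iff hy ht.1).1 ht
  have h0 := ht.1.1
  have hgap := neighborGap_eq hy k ε
  rw [hk] at hj hd
  have hne : v (k + (ε : ℤ)) = ε → y j ≠ y (k + (ε : ℤ)) := fun h h2 =>
    hj (by rw [hy.injective h2, h])
  rcases Int.units_eq_one_or ε with rfl | rfl
  · simp only [Units.val_one, Int.cast_one, one_mul] at hd hgap
    have hlt : k < j := hy.lt_iff_lt.1 (by linarith)
    have := hy.monotone (show k + 1 ≤ j by linarith)
    refine ⟨by linarith, fun h h2 => hne h ?_⟩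
    simp only [Units.val_one]; linarith
  · simp only [Units.val_neg, Units.val_one, Int.cast_neg, Int.cast_one] at hd hgap
    have hlt : j < k := hy.lt_iff_lt.1 (by linarith)
    have := hy.monotone (show j ≤ k + -1 by linarith)
    refine ⟨by linarith, fun h h2 => hne h ?_⟩
    simp only [Units.val_neg, Units.val_one]; linarith

end

/-! ### Determinism -/

/-- Applied to the difference of two motions that agree before `t`: they also agree in position and
arrival velocity at `t`. Comparing the times `t - δ` and `t - δ / 2` gives an integer `w * δ / 2`,
which is zero for small `δ`. -/
theorem eq_zero_of_eventually_coe_mul {t w : ℝ} {a : UnitAddCircle}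
    (h : ∀ᶠ s in 𝓝[<] t, a = ((w * (t - s) : ℝ) : UnitAddCircle)) : a = 0 ∧ w = 0 := by
  obtain ⟨l, hl, hs⟩ := mem_nhdsLT_iff_exists_Ioo_subset.1 h
  have hl : l < t := hl
  have hw : (0 : ℝ) < |w| + 1 := by positivity
  obtain ⟨δ, hδ0, hδ⟩ := exists_between (lt_min (sub_pos.2 hl) (one_div_pos.2 hw))
  have h1 := hs (show t - δ ∈ Ioo l t from
    ⟨by linarith [min_le_left (t - l) (1 / (|w| + 1))], by linarith⟩)
  have h2 := hs (show t - δ / 2 ∈ Ioo l t from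
    ⟨by linarith [min_le_left (t - l) (1 / (|w| + 1))], by linarith⟩)
  simp only [mem_ofPred_eq, sub_sub_cancel] at h1 h2
  obtain ⟨m, hm⟩ := unitAddCircle_coe_eq_iff.1 (h1.symm.trans h2)
  have h3 : |w| * δ < 1 := by
    have h4 := (lt_div_iff₀ hw).1 (lt_of_lt_of_le hδ (min_le_right _ _))
    nlinarith [abs_nonneg w]
  have h5 : |(m : ℝ)| < 1 := by
    rw [show (m : ℝ) = w * δ / 2 by linarith, abs_div, abs_mul, abs_of_pos hδ0, abs_two]
    linarith [mul_nonneg (abs_nonneg w) hδ0.le]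
  have hm0 : m = 0 := Int.abs_lt_one_iff.1 (by exact_mod_cast h5)
  rw [hm0] at hm
  have hw0 : w = 0 := by
    have : w * δ = 0 := by push_cast at hm; linarith
    rcases mul_eq_zero.1 this with h | h
    · exact h
    · linarith
  exact ⟨by rw [h1, hw0, zero_mul, AddCircle.coe_zero], hw0⟩

/-- The past of `t` determines positions and arrival velocities at `t`, the collision rule then
gives the departure velocities, and these fix the motion just after `t`. -/
theorem IsMotion.unique {n : ℕ} {p : Fin n → UnitAddCircle} {v₀ : Fin n → ℝ}
    {X X' : Fin n → ℝ → UnitAddCircle} {vin vin' vout vout' : Fin n → ℝ → ℝ}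
    (h : IsMotion p v₀ X vin vout) (h' : IsMotion p v₀ X' vin' vout') :
    ∀ t ∈ Icc (0 : ℝ) 1, ∀ i, X i t = X' i t := by
  refine Icc_induction fun t ht hlt => ?_
  have key : (∀ i, X i t = X' i t) ∧ (t < 1 → ∀ i, vout i t = vout' i t) := by
    rcases ht.1.eq_or_lt with h0 | h0
    · rw [← h0]
      exact ⟨fun i => by rw [h.start, h'.start], fun _ i => by rw [h.launch, h'.launch]⟩
    · have h1 : ∀ i, X i t - X' i t = 0 ∧ vin i t - vin' i t = 0 := fun i => by
        refine eq_zero_of_eventually_coe_mul (t := t) ?_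
        filter_upwards [h.arrive i t ⟨h0, ht.2⟩, h'.arrive i t ⟨h0, ht.2⟩, Ioo_mem_nhdsLT h0]
          with s e1 e2 hs
        rw [e1, e2, hlt s ⟨hs.1.le, hs.2⟩ i, add_sub_add_left_eq_sub, ← AddCircle.coe_sub, sub_mul]
      have h2 : ∀ i, X i t = X' i t := fun i => sub_eq_zero.1 (h1 i).1
      refine ⟨h2, fun ht1 i => ?_⟩
      have hv : vin i t = vin' i t := sub_eq_zero.1 (h1 i).2
      have hm : Meets X i t ↔ Meets X' i t := by simp only [Meets, h2]
      by_cases hmt : Meets X i t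
      · rw [h.bounce i t ⟨h0, ht1⟩ hmt, h'.bounce i t ⟨h0, ht1⟩ (hm.1 hmt), hv]
      · rw [h.keep i t ⟨h0, ht1⟩ hmt, h'.keep i t ⟨h0, ht1⟩ (fun h3 => hmt (hm.2 h3)), hv]
  refine ⟨key.1, fun ht1 => eventually_all.2 fun i => ?_⟩
  filter_upwards [h.leave i t ⟨ht.1, ht1⟩, h'.leave i t ⟨ht.1, ht1⟩] with s e1 e2
  rw [e1, e2, key.1, key.2 ht1]

theorem IsColl.unique {n : ℕ} {X X' : Fin n → ℝ → UnitAddCircle}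
    (hX : ∀ t ∈ Icc (0 : ℝ) 1, ∀ i, X i t = X' i t) {i : Fin n} {c c' : Option ℝ}
    (h : IsColl X i c) (h' : IsColl X' i c') : c = c' := by
  have hm : ∀ t ∈ Icc (0 : ℝ) 1, Meets X i t ↔ Meets X' i t := fun t ht => by
    simp only [Meets, hX t ht]
  cases c with
  | none =>
    cases c' with
    | none => rfl
    | some b =>
      obtain ⟨t, ht, hmt, _⟩ := h'
      exact absurd ((hm t ht).2 hmt) (h t ht)
  | some a =>
    obtain ⟨t, ht, hmt, hl, ha⟩ := h
    cases c' with
    | none => exact absurd ((hm t ht).1 hmt) (h' t ht)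
    | some b =>
      obtain ⟨t', ht', hmt', hl', hb⟩ := h'
      have : t = t' := by
        rcases lt_trichotomy t t' with h1 | h1 | h1
        · exact absurd ((hm t ht).1 hmt) (hl' t ⟨ht.1, h1⟩)
        · exact h1
        · exact absurd ((hm t' ht').2 hmt') (hl t' ⟨ht'.1, h1⟩)
      rw [ha, hb, ← this, hX t ht, hX 0 (by simp)]

theorem IsRound.unique {n : ℕ} {σ : Fin n → ℤˣ} {p : Fin n → UnitAddCircle} {d : Fin n → Dir}
    {o o' : Fin n → Obs} {q q' : Fin n → UnitAddCircle}
    (h : IsRound σ p d o q) (h' : IsRound σ p d o' q') : o = o' ∧ q = q' := by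
  obtain ⟨X, vin, vout, hX, hobs⟩ := h
  obtain ⟨X', vin', vout', hX', hobs'⟩ := h'
  have hu := hX.unique hX'
  have hq : q = q' := funext fun i => by
    rw [(hobs i).1, (hobs' i).1, hu 1 (by simp)]
  refine ⟨funext fun i => ?_, hq⟩
  obtain ⟨-, ⟨hr, he⟩, hc⟩ := hobs i
  obtain ⟨-, ⟨hr', he'⟩, hc'⟩ := hobs' i
  have h1 := hc.unique hu hc'
  -- The end point determines `dist` only modulo `1`; the range `[0, 1)` does the rest.
  have h2 : (o i).dist = (o' i).dist := by
    rw [hq, he', add_right_inj] at he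
    obtain ⟨m, hm⟩ := unitAddCircle_coe_eq_iff.1 he
    have : ∃ k : ℤ, (o i).dist = (o' i).dist + k := by
      rcases Int.units_eq_one_or (σ i) with h | h <;> rw [h] at hm <;> push_cast at hm
      · exact ⟨-m, by push_cast; linarith⟩
      · exact ⟨m, by linarith⟩
    obtain ⟨k, hk⟩ := this
    have h3 : |(k : ℝ)| < 1 := by
      rw [abs_lt]; constructor <;> linarith [hr.1, hr.2, hr'.1, hr'.2]
    have hk0 : k = 0 := Int.abs_lt_one_iff.1 (by exact_mod_cast h3)
    rw [hk, hk0, Int.cast_zero, add_zero]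
  cases hoi : o i
  cases hoi' : o' i
  rw [hoi, hoi'] at h1 h2
  simp only at h1 h2
  rw [h1, h2]

/-- The agent `i₀` tells a halted run from a continuing one; without agents both constructors would
always apply. -/
theorem Run.unique {n : ℕ} {α : Type} {σ : Fin n → ℤˣ} (i₀ : Fin n)
    {P : Fin n → AgentProg α} {p q q' : Fin n → UnitAddCircle}
    {t t' : ℕ} {a a' : Fin n → α} (h : Run σ P p t a q) (h' : Run σ P p t' a' q') :
    t = t' ∧ a = a' ∧ q = q' := by
  induction h generalizing t' with
  | halt P p a hP =>
    cases h' with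
    | halt _ _ _ hP' =>
      refine ⟨rfl, funext fun i => ?_, rfl⟩
      have := (hP i).symm.trans (hP' i)
      injection this
    | step _ _ _ _ _ _ _ _ _ hP' _ _ =>
      have := (hP i₀).symm.trans (hP' i₀)
      cases this
  | step P d next o p p' q t a hP hround hrest ih =>
    cases h' with
    | halt _ _ _ hP' =>
      have := (hP i₀).symm.trans (hP' i₀)
      cases this
    | step _ d' next' o' _ p'' _ t' _ hP' hround' hrest' =>
      have hd : d = d' := funext fun i => by
        have := (hP i).symm.trans (hP' i)
        injection this
      have hnext : next = next' := funext fun i => by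
        have := (hP i).symm.trans (hP' i)
        injection this
      subst hd hnext
      obtain ⟨rfl, rfl⟩ := hround.unique hround'
      obtain ⟨rfl, ha, hq⟩ := ih hrest'
      exact ⟨rfl, ha, hq⟩

/-- `Run` makes all agents finish the first program in the same round, so they enter the second one
synchronously. -/
theorem Run.bind {n : ℕ} {α β : Type} {σ : Fin n → ℤˣ} {P : Fin n → AgentProg α}
    {f : Fin n → α → AgentProg β} {p q r : Fin n → UnitAddCircle} {t t' : ℕ} {a : Fin n → α}
    {b : Fin n → β} (h : Run σ P p t a q) (h' : Run σ (fun i => f i (a i)) q t' b r) :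
    Run σ (fun i => P i >>= f i) p (t + t') b r := by
  induction h with
  | halt P p a hP =>
    have : (fun i => P i >>= f i) = fun i => f i (a i) := funext fun i => by rw [hP i]; rfl
    rw [this, zero_add]; exact h'
  | step P d next o p p' q t a hP hround hrest ih =>
    rw [Nat.add_right_comm]
    exact Run.step _ d (fun i x => next i x >>= f i) o p p' _ _ _
      (fun i => by rw [hP i]; rfl) hround (ih h')

theorem Run.pure {n : ℕ} {α : Type} {σ : Fin n → ℤˣ} (a : Fin n → α)
    (p : Fin n → UnitAddCircle) : Run σ (fun i => (Pure.pure (a i) : AgentProg α)) p 0 a p :=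
  Run.halt _ _ _ fun _ => rfl

/-! ### The effect of a round -/

noncomputable section

variable {n : ℕ} [NeZero n] {y : ℤ → ℝ}

/-- The positions of the agents on the ring. -/
def place (n : ℕ) (y : ℤ → ℝ) : Fin n → UnitAddCircle := fun i => (y (i : ℕ) : UnitAddCircle)

theorem place_agentAt (hy : IsRingLift n y) (k : ℤ) : place n y (agentAt n k) = (y k : ℝ) := by
  obtain ⟨m, hm⟩ := agentAt_eq_add_mul (n := n)
    (show agentAt n ((agentAt n k : ℕ) : ℤ) = agentAt n k by simp)
  exact unitAddCircle_coe_eq_iff.2 ⟨m, by rw [hm, hy.add_mul]⟩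

/-- The objective initial velocities. -/
def velocity {n : ℕ} (σ : Fin n → ℤˣ) (d : Fin n → Dir) (i : Fin n) : ℤˣ := σ i * (d i).sign

/-- The number of agents that start clockwise minus the number of those that start anticlockwise. -/
def netVelocity {n : ℕ} (σ : Fin n → ℤˣ) (d : Fin n → Dir) : ℤ := ∑ i, (velocity σ d i : ℤ)

/-- What an agent with initial velocity `ε` learns from its first collision: it is in the middle
between the agent and its neighbour, if that neighbour approaches, and further away otherwise. -/
structure CollSpec (y : ℤ → ℝ) (σ : Fin n → ℤˣ) (d : Fin n → Dir) (i : Fin n)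
    (o : Option ℝ) : Prop where
  approach : velocity σ d (agentAt n ((i : ℕ) + (velocity σ d i : ℤ))) ≠ velocity σ d i →
    o = some (neighborGap y (i : ℕ) (velocity σ d i) / 2)
  le : ∀ c, o = some c → neighborGap y (i : ℕ) (velocity σ d i) / 2 ≤ c
  recede : velocity σ d (agentAt n ((i : ℕ) + (velocity σ d i : ℤ))) = velocity σ d i →
    o ≠ some (neighborGap y (i : ℕ) (velocity σ d i) / 2)

/-- The round is realised by the ghosts. Its end configuration is the old lift with shifted
numbering, again a ring lift, so rounds can be chained. -/
theorem exists_isRound (hy : IsRingLift n y) (σ : Fin n → ℤˣ) (d : Fin n → Dir) :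
    ∃ o, IsRound σ (place n y) d o (place n fun k => y (k + netVelocity σ d)) ∧
      ∀ i, CollSpec y σ d i (o i).coll ∧
        (o i).dist = Int.fract (((σ i : ℤ) : ℝ) * (y ((i : ℕ) + netVelocity σ d) - y (i : ℕ))) := by
  let v : ℤ → ℤˣ := fun k => velocity σ d (agentAt n k)
  have hv : ∀ k, v (k + n) = v k := fun k => by simp only [v, agentAt_add_period]
  have hvi : ∀ i : Fin n, v (i : ℕ) = velocity σ d i := fun i => by
    simp only [v, agentAt_natCast]
  choose c hc hnone hsome using exists_isColl_ringMotion hy hv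
  have hmot := isMotion_ringMotion hy hv
  simp only [hvi] at hmot
  refine ⟨fun i => ⟨Int.fract (((σ i : ℤ) : ℝ) * (y ((i : ℕ) + netVelocity σ d) - y (i : ℕ))), c i⟩,
    ⟨ringMotion hy hv, _, _, hmot, fun i => ⟨?_, ⟨?_, ?_⟩, hc i⟩⟩,
    fun i => ⟨⟨fun h => ?_, fun b hb => ?_, fun h hb => ?_⟩, rfl⟩⟩
  · rw [ringMotion, track_one]
    simp only [hvi]; rfl
  · exact ⟨Int.fract_nonneg _, Int.fract_lt_one _⟩
  · rw [place, place, ← AddCircle.coe_add, unitAddCircle_coe_eq_iff]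
    refine ⟨((σ i : ℤˣ) : ℤ) *
      ⌊((σ i : ℤ) : ℝ) * (y ((i : ℕ) + netVelocity σ d) - y (i : ℕ))⌋, ?_⟩
    simp only [← Int.self_sub_floor]
    rcases Int.units_eq_one_or (σ i) with h | h <;> rw [h] <;> push_cast <;> ring
  · have hm := neighborGap_half_mem hy _ (hvi i) h
    cases hci : c i with
    | none => rw [hnone i hci] at hm; exact absurd hm (notMem_empty _)
    | some b =>
      have hl := hsome i b hci
      exact hci.trans <| congrArg some (le_antisymm (hl.2 hm)
        (neighborGap_half_le hy.mono (hvi i) hl.1).1)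
  · exact (neighborGap_half_le hy.mono (hvi i) (hsome i b hb).1).1
  · exact (neighborGap_half_le hy.mono (hvi i) (hsome i _ hb).1).2 h rfl

/-! ### Rotation index -/

theorem finRotate_apply_eq (i : Fin n) : finRotate n i = agentAt n ((i : ℕ) + 1) := by
  obtain ⟨m, rfl⟩ := Nat.exists_eq_succ_of_ne_zero (NeZero.ne n)
  rw [finRotate_apply, Fin.ext_iff, ← Int.natCast_inj, agentAt_val, Fin.val_add]
  simp

theorem finRotate_pow_apply (r : ℕ) (i : Fin n) :
    (finRotate n ^ r) i = agentAt n ((i : ℕ) + r) := by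
  induction r with
  | zero => simp
  | succ r ih =>
    rw [pow_succ', Equiv.Perm.mul_apply, ih, finRotate_apply_eq, agentAt_val_add]
    push_cast; rw [add_assoc]

/-- The rotation index is `s % n`, and the values `0` and `n / 2` are those with `n ∣ 2 * s`. -/
theorem isNontrivialMove_shift (hy : IsRingLift n y) {s : ℤ} (hs : ¬ (n : ℤ) ∣ 2 * s) :
    IsNontrivialMove (place n y) (place n fun k => y (k + s)) := by
  have hn := intCast_pos_of_neZero (n := n)
  have hr := Int.emod_nonneg s hn.ne'
  have hlt := Int.emod_lt_of_pos s hn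
  have hdiv := Int.emod_add_mul_ediv s n
  have hcast : (((s % n).toNat : ℕ) : ℤ) = s % n := Int.toNat_of_nonneg hr
  refine ⟨(s % n).toNat, ⟨by omega, fun i => ?_⟩, fun h => hs ?_, fun h => hs ?_⟩
  · rw [finRotate_pow_apply, place_agentAt hy, hcast]
    refine unitAddCircle_coe_eq_iff.2 ⟨s / n, ?_⟩
    rw [← hy.add_mul]
    exact congrArg y (by linarith)
  · exact Dvd.dvd.mul_left ⟨s / n, by omega⟩ 2
  · have h2 : 2 * (s % n) = n := by rw [← hcast]; exact_mod_cast h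
    refine ⟨1 + 2 * (s / n), ?_⟩
    linarith

theorem givesNontrivialMove_of_not_dvd (hy : IsRingLift n y) {σ : Fin n → ℤˣ} {d : Fin n → Dir}
    (h : ¬ (n : ℤ) ∣ 2 * netVelocity σ d) : GivesNontrivialMove σ (place n y) d := by
  obtain ⟨o, ho, -⟩ := exists_isRound hy σ d
  refine ⟨⟨o, _, ho⟩, fun o' q' h' => ?_⟩
  rw [(h'.unique ho).2]
  exact isNontrivialMove_shift hy h

omit [NeZero n] in
-- With the doubled net velocity as `s`, this shows that a failed test leaves the configuration
-- unchanged.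
theorem place_shift_of_dvd (hy : IsRingLift n y) {s : ℤ} (hs : (n : ℤ) ∣ s) :
    place n (fun k => y (k + s)) = place n y := by
  obtain ⟨m, rfl⟩ := hs
  exact funext fun i => unitAddCircle_coe_eq_iff.2 ⟨m, hy.add_mul _ _⟩

/-! ### Runs of the elementary programs -/

theorem run_singleRound {n : ℕ} {σ : Fin n → ℤˣ} {p q : Fin n → UnitAddCircle} {d : Fin n → Dir}
    {o : Fin n → Obs} (h : IsRound σ p d o q) :
    Run σ (fun i => singleRound (d i)) p 1 o q :=
  Run.step _ d (fun _ => .done) o p q q 0 o (fun _ => rfl) h (Run.halt _ _ _ fun _ => rfl)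

theorem dir_sign_opp (d : Dir) : d.opp.sign = -d.sign := by cases d <;> rfl

theorem netVelocity_opp {n : ℕ} (σ : Fin n → ℤˣ) (d : Fin n → Dir) :
    netVelocity σ (fun i => (d i).opp) = -netVelocity σ d := by
  simp [netVelocity, velocity, dir_sign_opp]

/-- Opposite directions negate the net velocity, so the second shift undoes the first. -/
theorem exists_run_roundTrip (hy : IsRingLift n y) (σ : Fin n → ℤˣ) (d : Fin n → Dir) :
    ∃ o : Fin n → Obs, Run σ (fun i => roundTrip (d i)) (place n y) 2 o (place n y) ∧
      ∀ i, CollSpec y σ d i (o i).coll := by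
  obtain ⟨o, ho, hs⟩ := exists_isRound hy σ d
  obtain ⟨o', ho', -⟩ := exists_isRound (hy.shift (netVelocity σ d)) σ fun i => (d i).opp
  simp only [netVelocity_opp, neg_add_cancel_right] at ho'
  refine ⟨o, ?_, fun i => (hs i).1⟩
  change Run σ (fun i => singleRound (d i) >>= fun x =>
    singleRound (d i).opp >>= fun _ => Pure.pure x) _ _ _ _
  exact (run_singleRound ho).bind (f := fun i x => singleRound (d i).opp >>= fun _ => Pure.pure x)
    ((run_singleRound ho').bind (Run.pure o _))

omit [NeZero n] in
theorem exists_int_sub_eq_iff (hy : IsRingLift n y) (a b : ℤ) :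
    (∃ m : ℤ, y a - y b = m) ↔ (n : ℤ) ∣ a - b := by
  constructor
  · rintro ⟨m, hm⟩
    have : y a = y (b + n * m) := by rw [hy.add_mul]; linarith
    exact ⟨m, by rw [hy.mono.injective this]; ring⟩
  · rintro ⟨m, hm⟩
    exact ⟨m, by rw [show a = b + n * m by linarith, hy.add_mul]; ring⟩

omit [NeZero n] in
-- The two signed displacements add up to an integer iff `n ∣ 2 * s`. In that case their fractional
-- parts sum to `0` or `1`, and a nonzero first part excludes `0`. The criterion does not involve
-- `σ` or `i`, so all agents reach the same verdict.
theorem dist_test_iff (hy : IsRingLift n y) (σ : ℤˣ) (i s : ℤ) :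
    (Int.fract (((σ : ℤ) : ℝ) * (y (i + s) - y i)) ≠ 0 ∧
      Int.fract (((σ : ℤ) : ℝ) * (y (i + s) - y i)) +
        Int.fract (((σ : ℤ) : ℝ) * (y (i + s + s) - y (i + s))) ≠ 1) ↔ ¬ (n : ℤ) ∣ 2 * s := by
  set a := ((σ : ℤ) : ℝ) * (y (i + s) - y i) with ha
  set b := ((σ : ℤ) : ℝ) * (y (i + s + s) - y (i + s)) with hb
  have hint : ∀ x : ℝ, (∃ m : ℤ, ((σ : ℤ) : ℝ) * x = m) → ∃ m : ℤ, x = m := by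
    rintro x ⟨m, hm⟩
    rcases Int.units_eq_one_or σ with h | h <;> rw [h] at hm <;> push_cast at hm
    · exact ⟨m, by linarith⟩
    · exact ⟨-m, by push_cast; linarith⟩
  have hab : a + b = ((σ : ℤ) : ℝ) * (y (i + s + s) - y i) := by rw [ha, hb]; ring
  have fa := Int.floor_add_fract a
  have fb := Int.floor_add_fract b
  constructor
  · rintro ⟨h0, h1⟩ hdvd
    obtain ⟨m, hm⟩ := (exists_int_sub_eq_iff hy (i + s + s) i).2 (by convert hdvd using 1; ring)
    rw [hm] at hab
    have h2 : Int.fract a + Int.fract b = ((((σ : ℤ) * m - ⌊a⌋ - ⌊b⌋ : ℤ)) : ℝ) := by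
      push_cast; linarith
    have h3 : 0 < Int.fract a := lt_of_le_of_ne (Int.fract_nonneg a) (Ne.symm h0)
    have h4 := Int.fract_nonneg b
    have h5 := Int.fract_lt_one a
    have h6 := Int.fract_lt_one b
    rw [h2] at h1
    have l1 : (0 : ℤ) < (σ : ℤ) * m - ⌊a⌋ - ⌊b⌋ := by
      have : (0 : ℝ) < (((σ : ℤ) * m - ⌊a⌋ - ⌊b⌋ : ℤ) : ℝ) := by linarith
      exact_mod_cast this
    have l2 : (σ : ℤ) * m - ⌊a⌋ - ⌊b⌋ < 2 := by
      have : (((σ : ℤ) * m - ⌊a⌋ - ⌊b⌋ : ℤ) : ℝ) < 2 := by linarith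
      exact_mod_cast this
    exact h1 (by rw [show (σ : ℤ) * m - ⌊a⌋ - ⌊b⌋ = 1 by omega]; simp)
  · intro hnd
    refine ⟨fun h => hnd ?_, fun h => hnd ?_⟩
    · have := (exists_int_sub_eq_iff hy (i + s) i).1 (hint _ ⟨⌊a⌋, by rw [← ha]; linarith⟩)
      rw [add_sub_cancel_left] at this
      exact this.mul_left 2
    · have := (exists_int_sub_eq_iff hy (i + s + s) i).1
        (hint _ ⟨⌊a⌋ + ⌊b⌋ + 1, by rw [← hab]; push_cast; linarith⟩)
      convert this using 1; ring

open Classical in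
theorem run_testMove (hy : IsRingLift n y) (σ : Fin n → ℤˣ) (d : Fin n → Dir) :
    Run σ (fun i => testMove (d i)) (place n y) 2
      (fun _ => decide (¬ (n : ℤ) ∣ 2 * netVelocity σ d))
      (place n fun k => y (k + 2 * netVelocity σ d)) := by
  obtain ⟨o, ho, hs⟩ := exists_isRound hy σ d
  obtain ⟨o', ho', hs'⟩ := exists_isRound (hy.shift (netVelocity σ d)) σ d
  have h := (run_singleRound ho).bind
    (f := fun i o₁ => singleRound (d i) >>= fun o₂ =>
      Pure.pure (decide (o₁.dist ≠ 0 ∧ o₁.dist + o₂.dist ≠ 1)))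
    ((run_singleRound ho').bind (Run.pure _ _))
  convert h using 1
  · rfl
  · funext i
    rw [(hs i).2, (hs' i).2]
    exact decide_eq_decide.2 (dist_test_iff hy (σ i) (i : ℕ) _).symm
  · exact congrArg (place n) (funext fun k => congrArg y (by ring))

end

noncomputable section

variable {n : ℕ} [NeZero n] {y : ℤ → ℝ}

/-! ### Neighbour discovery -/

/-- The neighbour of agent `i` on its side `s`. -/
def neighbor (σ : Fin n → ℤˣ) (i : Fin n) (s : Dir) : Fin n :=
  agentAt n ((i : ℕ) + ((σ i * s.sign : ℤˣ) : ℤ))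

/-- The distance of agent `i` from its neighbour on its side `s`. -/
def sideGap (y : ℤ → ℝ) (σ : Fin n → ℤˣ) (i : Fin n) (s : Dir) : ℝ :=
  neighborGap y (i : ℕ) (σ i * s.sign)

/-- The neighbour of agent `i` on the side `d i` starts towards it. -/
def Approaches (σ : Fin n → ℤˣ) (d : Fin n → Dir) (i : Fin n) : Prop :=
  velocity σ d (neighbor σ i (d i)) ≠ velocity σ d i

theorem CollSpec.eq_iff {σ : Fin n → ℤˣ} {d : Fin n → Dir} {i : Fin n} {o : Option ℝ}
    (h : CollSpec y σ d i o) : o = some (sideGap y σ i (d i) / 2) ↔ Approaches σ d i :=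
  ⟨fun ho hv => h.recede hv ho, h.approach⟩

theorem approaches_iff {σ : Fin n → ℤˣ} {d : Fin n → Dir} {i : Fin n} :
    Approaches σ d i ↔ (d (neighbor σ i (d i)) = d i ↔ σ (neighbor σ i (d i)) ≠ σ i) := by
  unfold Approaches velocity
  generalize neighbor σ i (d i) = j
  rcases Int.units_eq_one_or (σ i) with h | h <;> rcases Int.units_eq_one_or (σ j) with h' | h' <;>
    rw [h, h'] <;> cases d i <;> cases d j <;> decide

theorem addColl_spec {σ : Fin n → ℤˣ} {d : Fin n → Dir} {i : Fin n} {o : Obs}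
    (h : CollSpec y σ d i o.coll) (D : Dir → Set ℝ) (s : Dir) :
    D s ⊆ addColl D (d i) o s ∧
    (∀ x ∈ addColl D (d i) o s, x ∈ D s ∨ sideGap y σ i s / 2 ≤ x) ∧
    (d i = s → Approaches σ d i → sideGap y σ i s / 2 ∈ addColl D (d i) o s) := by
  by_cases hs : d i = s
  · subst hs
    rw [addColl, Function.update_self]
    exact ⟨subset_union_left, fun x hx => hx.imp id fun hx => h.le x hx,
      fun _ ha => Or.inr (h.eq_iff.2 ha)⟩
  · rw [addColl, Function.update_of_ne (Ne.symm hs)]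
    exact ⟨Subset.rfl, fun x hx => Or.inl hx, fun h2 => absurd h2 hs⟩

/-- The direction of an agent in the round of neighbour discovery with parameters `q`. -/
def probeDir (id : ℕ) (q : ℕ × Bool × Dir) : Dir :=
  if id.testBit q.1 = q.2.1 then q.2.2 else q.2.2.opp

/-- No recorded value is below half the gap, and half the gap is recorded once a probe makes the
neighbour approach; so the minimum is correct as soon as one suitable probe occurs. -/
theorem exists_run_probes (hy : IsRingLift n y) (σ : Fin n → ℤˣ) (ID : Fin n → ℕ)
    (l : List (ℕ × Bool × Dir)) (D₀ : Fin n → Dir → Set ℝ) :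
    ∃ D : Fin n → Dir → Set ℝ,
      Run σ (fun i => l.foldlM (probe (ID i)) (D₀ i)) (place n y) (2 * l.length) D (place n y) ∧
      ∀ i s, D₀ i s ⊆ D i s ∧ (∀ x ∈ D i s, x ∈ D₀ i s ∨ sideGap y σ i s / 2 ≤ x) ∧
        ∀ q ∈ l, probeDir (ID i) q = s → Approaches σ (fun j => probeDir (ID j) q) i →
          sideGap y σ i s / 2 ∈ D i s := by
  induction l generalizing D₀ with
  | nil => exact ⟨D₀, Run.halt _ _ _ fun _ => rfl, fun i s => ⟨Subset.rfl, fun x => Or.inl, by simp⟩⟩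
  | cons q l ih =>
    obtain ⟨o, ho, hs⟩ := exists_run_roundTrip hy σ fun i => probeDir (ID i) q
    obtain ⟨D, hD, hDs⟩ := ih fun i => addColl (D₀ i) (probeDir (ID i) q) (o i)
    refine ⟨D, ?_, fun i s => ?_⟩
    · have h1 : Run σ (fun i => probe (ID i) (D₀ i) q) (place n y) (2 + 0)
          (fun i => addColl (D₀ i) (probeDir (ID i) q) (o i)) (place n y) :=
        ho.bind (f := fun i x => Pure.pure (addColl (D₀ i) (probeDir (ID i) q) x)) (Run.pure _ _)
      have h2 := h1.bind (f := fun i D => l.foldlM (probe (ID i)) D) hD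
      convert h2 using 1
      · simp only [List.foldlM_cons]
      · rw [List.length_cons]; ring
    · obtain ⟨a1, a2, a3⟩ := addColl_spec (hs i) (D₀ i) s
      obtain ⟨b1, b2, b3⟩ := hDs i s
      refine ⟨a1.trans b1, fun x hx => (b2 x hx).elim (a2 x) Or.inr, fun q' hq' hd ha => ?_⟩
      rcases List.mem_cons.1 hq' with rfl | hq'
      · exact b1 (a3 hd ha)
      · exact b3 q' hq' hd ha

/-- The agents know the distances and the senses of direction of their neighbours. -/
def KnowsNeighbors (y : ℤ → ℝ) (σ : Fin n → ℤˣ) (nb : Fin n → NeighborInfo) : Prop :=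
  ∀ i s, (nb i).gap s = sideGap y σ i s ∧ (nb i).same s = decide (σ (neighbor σ i s) = σ i)

theorem neighbor_ne (hn : 1 < n) (σ : Fin n → ℤˣ) (i : Fin n) (s : Dir) : neighbor σ i s ≠ i := by
  intro h
  replace h := h.trans (agentAt_natCast i).symm
  rw [neighbor, agentAt_eq_iff, add_sub_cancel_left] at h
  have h2 := Int.natAbs_dvd_natAbs.2 h
  rw [Int.units_natAbs, Int.natAbs_natCast, Nat.dvd_one] at h2
  omega

theorem exists_testBit_ne {N a b : ℕ} (ha : a ≤ N) (hb : b ≤ N) (h : a ≠ b) :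
    ∃ i < N.size, a.testBit i ≠ b.testBit i := by
  by_contra! hcon
  refine h (Nat.eq_of_testBit_eq fun i => ?_)
  by_cases hi : i < N.size
  · exact hcon i hi
  · have hN := (Nat.lt_size_self N).trans_le (Nat.pow_le_pow_right two_pos (not_lt.1 hi))
    rw [Nat.testBit_eq_false_of_lt (ha.trans_lt hN), Nat.testBit_eq_false_of_lt (hb.trans_lt hN)]

theorem exists_run_neighborDiscovery (hy : IsRingLift n y) (hn : 1 < n) (σ : Fin n → ℤˣ) {N : ℕ}
    {ID : Fin n → ℕ} (hID : Function.Injective ID) (hIDN : ∀ i, ID i ≤ N) :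
    ∃ nb, Run σ (fun i => neighborDiscovery N (ID i)) (place n y) (8 * N.size + 4) nb (place n y) ∧
      KnowsNeighbors y σ nb := by
  obtain ⟨D, hD, hDs⟩ := exists_run_probes hy σ ID
    (List.range N.size ×ˢ [false, true] ×ˢ [Dir.left, Dir.right]) fun _ _ => ∅
  obtain ⟨oR, hoR, hR⟩ := exists_run_roundTrip hy σ fun _ => Dir.right
  obtain ⟨oL, hoL, hL⟩ := exists_run_roundTrip hy σ fun _ => Dir.left
  let E : Fin n → Dir → Set ℝ := fun i => addColl (addColl (D i) .right (oR i)) .left (oL i)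
  have hE : ∀ i s, sInf (E i s) = sideGap y σ i s / 2 := by
    intro i s
    obtain ⟨a1, a2, a3⟩ := hDs i s
    obtain ⟨b1, b2, b3⟩ := addColl_spec (hR i) (D i) s
    obtain ⟨c1, c2, c3⟩ := addColl_spec (hL i) (addColl (D i) .right (oR i)) s
    refine IsLeast.csInf_eq ⟨?_, fun x hx => ?_⟩
    · by_cases hσ : σ (neighbor σ i s) = σ i
      · obtain ⟨b, hb, hne⟩ := exists_testBit_ne (hIDN i) (hIDN (neighbor σ i s))
          fun h => neighbor_ne hn σ i s (hID h).symm
        -- In this probe agent `i` starts towards `s`, and its neighbour, with another bit at `b`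
        -- but the same sense of direction, starts towards `i`. Neighbours of opposite sense
        -- approach when all agents start towards `s`.
        refine c1 (b1 (a3 (b, (ID i).testBit b, s) ?_ (by simp [probeDir]) ?_))
        · refine List.pair_mem_product.2 ⟨List.mem_range.2 hb, List.pair_mem_product.2 ⟨?_, ?_⟩⟩
          · cases (ID i).testBit b <;> simp
          · cases s <;> simp
        · rw [approaches_iff]
          simp only [probeDir, if_true, hσ, ne_eq, not_true_eq_false, iff_false]
          rw [if_neg hne.symm]
          cases s <;> decide
      · cases s with
        | right => exact c1 (b3 rfl (approaches_iff.2 (by simpa using hσ)))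
        | left => exact c3 rfl (approaches_iff.2 (by simpa using hσ))
    · rcases c2 x hx with h | h
      · rcases b2 x h with h | h
        · rcases a2 x h with h | h
          · exact absurd h (notMem_empty _)
          · exact h
        · exact h
      · exact h
  refine ⟨fun i => NeighborInfo.mk (fun s => 2 * sInf (E i s))
    fun s => match s with
    | .right => decide ((oR i).coll ≠ some (sInf (E i .right)))
    | .left => decide ((oL i).coll ≠ some (sInf (E i .left))), ?_, ?_⟩
  · have h1 : 8 * N.size + 4 = 2 * (List.range N.size ×ˢ [false, true] ×ˢ
        [Dir.left, Dir.right]).length + (2 + (2 + 0)) := by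
      simp [List.length_product]; ring
    rw [h1]
    unfold neighborDiscovery
    exact hD.bind (hoR.bind (hoL.bind (Run.halt _ _ _ fun i => rfl)))
  · intro i s
    refine ⟨by simp only [hE]; ring, ?_⟩
    cases s with
    | right =>
      have := (hR i).eq_iff
      rw [approaches_iff] at this
      simp only [true_iff] at this
      simp only [hE, ne_eq, this, not_not]
    | left =>
      have := (hL i).eq_iff
      rw [approaches_iff] at this
      simp only [true_iff] at this
      simp only [hE, ne_eq, this, not_not]

/-! ### Communication between neighbours -/

/-- The collision tells whether the objective velocities are opposite; knowing the relative sense of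
direction translates this into the neighbour's own choice of direction. -/
theorem decode_bit {σ : Fin n → ℤˣ} {nb : Fin n → NeighborInfo} (hnb : KnowsNeighbors y σ nb)
    {d : Fin n → Dir} {i : Fin n} {s : Dir} {o : Option ℝ} (h : CollSpec y σ d i o)
    (hs : d i = s) :
    decide (o = some ((nb i).gap s / 2)) = (nb i).same s ↔ d (neighbor σ i s) ≠ s := by
  subst hs
  have h2 := h.eq_iff
  rw [approaches_iff] at h2
  rw [(hnb i (d i)).1, (hnb i (d i)).2, decide_eq_decide, h2]
  tauto

/-- In either trip two agents choose equal own directions iff their bits agree, so one decoding rule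
serves whichever trip starts towards `s`. -/
theorem run_exchangeBit (hy : IsRingLift n y) {σ : Fin n → ℤˣ} {nb : Fin n → NeighborInfo}
    (hnb : KnowsNeighbors y σ nb) (z : Fin n → Bool) :
    Run σ (fun i => exchangeBit (nb i) (z i)) (place n y) 4
      (fun i s => z (neighbor σ i s)) (place n y) := by
  obtain ⟨o₁, ho₁, h₁⟩ := exists_run_roundTrip hy σ fun i => if z i then Dir.right else Dir.left
  obtain ⟨o₃, ho₃, h₃⟩ := exists_run_roundTrip hy σ fun i => if z i then Dir.left else Dir.right
  change Run σ _ _ (2 + (2 + 0)) _ _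
  unfold exchangeBit
  refine ho₁.bind (ho₃.bind (Run.halt _ _ _ fun i => congrArg AgentProg.done (funext fun s => ?_)))
  have k₁ := @decode_bit n _ y σ nb hnb _ i s _ (h₁ i)
  have k₃ := @decode_bit n _ y σ nb hnb _ i s _ (h₃ i)
  by_cases hs : s = (if z i then Dir.right else Dir.left)
  · rw [if_pos hs]
    simp only [k₁ hs.symm]
    cases hz : z i <;> cases hz' : z (neighbor σ i s) <;> simp [hz, hs]
  · have hs' : (if z i then Dir.left else Dir.right) = s := by
      cases hz : z i <;> cases s <;> simp_all
    rw [if_neg hs]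
    simp only [k₃ hs']
    cases hz : z i <;> cases hz' : z (neighbor σ i s) <;> simp [hz, ← hs']

/-- The side of the neighbour on side `s` on which agent `i` is. -/
def facingSide (σ : Fin n → ℤˣ) (i : Fin n) (s : Dir) : Dir :=
  if σ (neighbor σ i s) = σ i then s.opp else s

theorem run_exchangeBits (hy : IsRingLift n y) {σ : Fin n → ℤˣ} {nb : Fin n → NeighborInfo}
    (hnb : KnowsNeighbors y σ nb) (z : Fin n → Dir → Bool) :
    Run σ (fun i => exchangeBits (nb i) (z i)) (place n y) 8
      (fun i s => z (neighbor σ i s) (facingSide σ i s)) (place n y) := by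
  change Run σ _ _ (4 + (4 + 0)) _ _
  unfold exchangeBits
  refine (run_exchangeBit hy hnb _).bind ((run_exchangeBit hy hnb _).bind
    (Run.halt _ _ _ fun i => congrArg AgentProg.done (funext fun s => ?_)))
  simp only [(hnb i s).2, decide_eq_true_eq]
  change _ = z (neighbor σ i s) (if σ (neighbor σ i s) = σ i then s.opp else s)
  generalize (if σ (neighbor σ i s) = σ i then s.opp else s) = side
  cases side <;> rfl

theorem run_exchangeSymbols (hy : IsRingLift n y) {σ : Fin n → ℤˣ} {nb : Fin n → NeighborInfo}
    (hnb : KnowsNeighbors y σ nb) (z : Fin n → Dir → Option Bool) :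
    Run σ (fun i => exchangeSymbols (nb i) (z i)) (place n y) 16
      (fun i s => z (neighbor σ i s) (facingSide σ i s)) (place n y) := by
  change Run σ _ _ (8 + (8 + 0)) _ _
  unfold exchangeSymbols
  refine (run_exchangeBits hy hnb _).bind ((run_exchangeBits hy hnb _).bind
    (Run.halt _ _ _ fun i => congrArg AgentProg.done (funext fun s => ?_)))
  cases h : z (neighbor σ i s) (facingSide σ i s) <;> simp [h]

end

noncomputable section

variable {n : ℕ} [NeZero n] {y : ℤ → ℝ}

/-! ### Dissemination -/

/-- The agent at ring distance `h` from agent `i` on its side `s`. -/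
def along (σ : Fin n → ℤˣ) (i : Fin n) (s : Dir) (h : ℕ) : Fin n :=
  agentAt n ((i : ℕ) + h * ((σ i * s.sign : ℤˣ) : ℤ))

theorem along_one (σ : Fin n → ℤˣ) (i : Fin n) (s : Dir) : along σ i s 1 = neighbor σ i s := by
  simp [along, neighbor]

/-- Leaving the neighbour by the side opposite to the one facing `i` continues in the same objective
direction; hence relays pass messages straight on whatever their senses of direction. -/
theorem sign_facingSide (σ : Fin n → ℤˣ) (i : Fin n) (s : Dir) :
    σ (neighbor σ i s) * (facingSide σ i s).opp.sign = σ i * s.sign := by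
  unfold facingSide
  generalize neighbor σ i s = j
  rcases Int.units_eq_one_or (σ i) with h | h <;> rcases Int.units_eq_one_or (σ j) with h' | h' <;>
    rw [h, h'] <;> cases s <;> decide

theorem along_succ (σ : Fin n → ℤˣ) (i : Fin n) (s : Dir) (h : ℕ) :
    along σ i s (h + 1) = along σ (neighbor σ i s) (facingSide σ i s).opp h := by
  rw [along, along, sign_facingSide]
  conv_rhs => rw [neighbor, agentAt_val_add]
  congr 1
  push_cast; ring

/-- What an agent transmits in step `q` of a dissemination. -/
def dissOut (msg : Option (List Bool)) (st : DissState) (q : ℕ) : Dir → Option Bool :=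
  match msg with
  | some m => fun _ => m[q]?
  | none => fun s => st.last s.opp

/-- The states of the agents after step `q` of a dissemination. -/
def dissNext (σ : Fin n → ℤˣ) (msg : Fin n → Option (List Bool)) (st : Fin n → DissState) (q : ℕ)
    (i : Fin n) : DissState :=
  let inc : Dir → Option Bool := fun s =>
    dissOut (msg (neighbor σ i s)) (st (neighbor σ i s)) q (facingSide σ i s)
  { last := inc, buf := fun s => (st i).buf s ++ (inc s).toList }

theorem run_dissStep (hy : IsRingLift n y) {σ : Fin n → ℤˣ} {nb : Fin n → NeighborInfo}
    (hnb : KnowsNeighbors y σ nb) (msg : Fin n → Option (List Bool)) (st : Fin n → DissState)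
    (q : ℕ) :
    Run σ (fun i => dissStep (nb i) (msg i) (st i) q) (place n y) 16 (dissNext σ msg st q)
      (place n y) := by
  change Run σ _ _ (16 + 0) _ _
  unfold dissStep
  exact (run_exchangeSymbols hy hnb fun i => dissOut (msg i) (st i) q).bind
    (Run.halt _ _ _ fun i => rfl)

theorem run_dissSteps (hy : IsRingLift n y) {σ : Fin n → ℤˣ} {nb : Fin n → NeighborInfo}
    (hnb : KnowsNeighbors y σ nb) (msg : Fin n → Option (List Bool)) (l : List ℕ)
    (st : Fin n → DissState) :
    Run σ (fun i => l.foldlM (dissStep (nb i) (msg i)) (st i)) (place n y) (16 * l.length)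
      (l.foldl (dissNext σ msg) st) (place n y) := by
  induction l generalizing st with
  | nil => exact Run.halt _ _ _ fun _ => rfl
  | cons q l ih =>
    simp only [List.foldlM_cons, List.foldl_cons, List.length_cons]
    rw [mul_add, mul_one, add_comm]
    exact (run_dissStep hy hnb msg st q).bind
      (f := fun i st => l.foldlM (dissStep (nb i) (msg i)) st) (ih _)

/-- At ring distance `h` from the agent `i` on its side `s` is the closest agent with a message. -/
structure IsNearest (σ : Fin n → ℤˣ) (msg : Fin n → Option (List Bool)) (i : Fin n) (s : Dir)
    (h : ℕ) (m : List Bool) : Prop where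
  pos : 0 < h
  eq_some : msg (along σ i s h) = some m
  eq_none : ∀ h', 0 < h' → h' < h → msg (along σ i s h') = none

/-- The states of the agents after `q` steps of a dissemination. -/
def dissStates (σ : Fin n → ℤˣ) (msg : Fin n → Option (List Bool)) (q : ℕ) : Fin n → DissState :=
  (List.range q).foldl (dissNext σ msg) fun _ => ⟨fun _ => none, fun _ => []⟩

/-- Bits advance one place per step. The sender towards `i` is either the source or a relay one
place closer to it, whose last symbol the induction hypothesis gives. Sources do not relay, so only
the nearest message arrives. -/
theorem dissStates_spec (σ : Fin n → ℤˣ) (msg : Fin n → Option (List Bool)) (q : ℕ) (i : Fin n)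
    (s : Dir) (h : ℕ) (m : List Bool) (hm : IsNearest σ msg i s h m) :
    (dissStates σ msg q i).buf s = m.take (q + 1 - h) ∧
      (dissStates σ msg q i).last s = if h ≤ q then m[q - h]? else none := by
  induction q generalizing i s h with
  | zero =>
    have := hm.pos
    rw [if_neg (by omega), show 0 + 1 - h = 0 by omega, List.take_zero]
    exact ⟨rfl, rfl⟩
  | succ q ih =>
    have hsucc : dissStates σ msg (q + 1) = dissNext σ msg (dissStates σ msg q) q := by
      simp only [dissStates, List.range_succ, List.foldl_append, List.foldl_cons, List.foldl_nil]
    rw [hsucc]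
    set st := dissStates σ msg q
    have hlast : (dissNext σ msg st q i).last s = if h ≤ q + 1 then m[q + 1 - h]? else none := by
      change dissOut (msg (neighbor σ i s)) (st (neighbor σ i s)) q (facingSide σ i s) = _
      obtain ⟨k, rfl⟩ := Nat.exists_eq_succ_of_ne_zero hm.pos.ne'
      rcases Nat.eq_zero_or_pos k with rfl | hk
      · rw [← along_one, hm.eq_some, if_pos (by omega)]
        rfl
      · rw [← along_one, hm.eq_none 1 one_pos (by omega), along_one]
        change (st (neighbor σ i s)).last (facingSide σ i s).opp = _
        rw [(ih (neighbor σ i s) (facingSide σ i s).opp k ⟨hk, ?_, fun h' h0 h1 => ?_⟩).2]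
        · simp only [Nat.succ_eq_add_one, Nat.add_le_add_iff_right, Nat.add_sub_add_right]
        · rw [← along_succ]; exact hm.eq_some
        · rw [← along_succ]; exact hm.eq_none _ (by omega) (by omega)
    refine ⟨?_, hlast⟩
    change (st i).buf s ++ ((dissNext σ msg st q i).last s).toList = _
    rw [hlast, (ih i s h hm).1]
    split_ifs with hq
    · rw [show q + 1 + 1 - h = (q + 1 - h) + 1 by omega, List.take_add_one]
    · rw [show q + 1 + 1 - h = 0 by omega, show q + 1 - h = 0 by omega]; simp

/-- An agent receives the message of the closest agent with a message, if that is not too far. -/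
theorem exists_run_disseminate (hy : IsRingLift n y) {σ : Fin n → ℤˣ} {nb : Fin n → NeighborInfo}
    (hnb : KnowsNeighbors y σ nb) (msg : Fin n → Option (List Bool)) {len d : ℕ} (hlen : 0 < len)
    (hd : 0 < d) (hmsg : ∀ i m, msg i = some m → m.length = len) :
    ∃ heard, Run σ (fun i => disseminate (nb i) (msg i) len d) (place n y) (16 * (len + d - 1))
        heard (place n y) ∧
      ∀ i s h m, IsNearest σ msg i s h m → heard i s = if h ≤ d then some m else none := by
  have hrun := run_dissSteps hy hnb msg (List.range (len + d - 1))
    fun _ => ⟨fun _ => none, fun _ => []⟩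
  rw [List.length_range] at hrun
  refine ⟨fun i s => if ((dissStates σ msg (len + d - 1) i).buf s).length = len then
    some ((dissStates σ msg (len + d - 1) i).buf s) else none, ?_, ?_⟩
  · rw [← add_zero (16 * _)]
    unfold disseminate
    exact hrun.bind (Run.halt _ _ _ fun i => rfl)
  · intro i s h m hm
    have hl := hmsg _ _ hm.eq_some
    have hpos := hm.pos
    simp only [(dissStates_spec σ msg (len + d - 1) i s h m hm).1]
    -- After `len + d - 1` steps the first `len + d - h` bits have arrived (truncated subtraction),
    -- so the message is complete exactly for `h ≤ d`.
    split_ifs with h1 h2 h2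
    · rw [List.take_of_length_le (by omega)]
    · rw [List.length_take] at h1; omega
    · rw [List.length_take] at h1; omega
    · rfl

theorem exists_along_eq (σ : Fin n → ℤˣ) (i : Fin n) (s : Dir) (a : Fin n) :
    ∃ h, 0 < h ∧ along σ i s h = a := by
  have hn := intCast_pos_of_neZero (n := n)
  set ε := σ i * s.sign with hε
  set x : ℤ := ((ε : ℤˣ) : ℤ) * (((a : ℕ) : ℤ) - (i : ℕ)) with hx
  have h0 := Int.emod_nonneg x hn.ne'
  have hdiv := Int.emod_add_mul_ediv x n
  -- The extra turn makes the distance positive even when `a = i`.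
  refine ⟨(x % n + n).toNat, by omega, ?_⟩
  rw [along, ← agentAt_natCast a, agentAt_eq_iff, Int.toNat_of_nonneg (by omega), ← hε]
  have hεε : ((ε : ℤˣ) : ℤ) * ((ε : ℤˣ) : ℤ) = 1 := by
    rw [← Units.val_mul, Int.units_mul_self]; rfl
  refine ⟨(ε : ℤ) * (1 - x / n), ?_⟩
  have : x * ((ε : ℤˣ) : ℤ) = ((a : ℕ) : ℤ) - (i : ℕ) := by
    rw [hx, mul_right_comm, hεε, one_mul]
  linear_combination this + (ε : ℤ) * hdiv

theorem exists_isNearest (σ : Fin n → ℤˣ) (msg : Fin n → Option (List Bool)) (i : Fin n) (s : Dir)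
    {a : Fin n} (ha : (msg a).isSome) : ∃ h m, IsNearest σ msg i s h m := by
  classical
  have hex : ∃ h, 0 < h ∧ (msg (along σ i s h)).isSome := by
    obtain ⟨h, h0, h1⟩ := exists_along_eq σ i s a
    exact ⟨h, h0, h1 ▸ ha⟩
  obtain ⟨m, hm⟩ := Option.isSome_iff_exists.1 (Nat.find_spec hex).2
  refine ⟨Nat.find hex, m, (Nat.find_spec hex).1, hm, fun h' h0 h1 => ?_⟩
  have := Nat.find_min hex h1
  rw [not_and, Bool.not_eq_true, Option.isSome_eq_false_iff] at this
  simpa using this h0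

theorem bitsToNat_map_testBit (L id : ℕ) (h : id < 2 ^ L) :
    bitsToNat ((List.range L).map id.testBit) = id := by
  induction L generalizing id with
  | zero => simp at h; simp [bitsToNat, h]
  | succ L ih =>
    have h2 : id / 2 < 2 ^ L := by rw [pow_succ] at h; omega
    have h3 := ih (id / 2) h2
    rw [List.range_succ_eq_map, List.map_cons, List.map_map]
    have h4 : id.testBit ∘ Nat.succ = (id / 2).testBit := by
      funext i; simp [Nat.testBit_succ]
    rw [h4]
    change Nat.bit (id.testBit 0) (bitsToNat ((List.range L).map (id / 2).testBit)) = id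
    rw [h3, Nat.bit_val, Nat.testBit_zero]
    by_cases h5 : id % 2 = 1
    · simp [h5]; omega
    · simp [h5]; omega

theorem bitsToNat_idBits {N id : ℕ} (h : id ≤ N) : bitsToNat (idBits N id) = id :=
  bitsToNat_map_testBit _ _ (h.trans_lt (Nat.lt_size_self N))

end

noncomputable section

variable {n : ℕ} [NeZero n] {y : ℤ → ℝ}

/-! ### Local leaders -/

/-- Two distinct marked agents are at ring distance more than `D`. -/
def Separated (L : Fin n → Bool) (D : ℕ) : Prop :=
  ∀ (i : Fin n) (h : ℕ), 0 < h → h ≤ D → L i = true → L (agentAt n ((i : ℕ) + h)) = true →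
    agentAt n ((i : ℕ) + h) = i

/-- The message of an agent: its ID, if it is a local leader. -/
def leaderMsg (N : ℕ) (ID : Fin n → ℕ) (L : Fin n → Bool) (i : Fin n) : Option (List Bool) :=
  if L i then some (idBits N (ID i)) else none

open Classical in
/-- The local leaders that keep this status. -/
def nextLeaders (ID : Fin n → ℕ) (L : Fin n → Bool) (heard : Fin n → Dir → Option (List Bool))
    (i : Fin n) : Bool :=
  L i && decide (∀ s m, heard i s = some m → bitsToNat m ≤ ID i)

/-- The messages that arrive when the IDs of the local leaders are disseminated to distance `d`. -/
def HeardWithin (σ : Fin n → ℤˣ) (N : ℕ) (ID : Fin n → ℕ) (L : Fin n → Bool) (d : ℕ)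
    (heard : Fin n → Dir → Option (List Bool)) : Prop :=
  ∀ i s h m, IsNearest σ (leaderMsg N ID L) i s h m → heard i s = if h ≤ d then some m else none

omit [NeZero n] in
theorem leaderMsg_eq_some {N : ℕ} {ID : Fin n → ℕ} {L : Fin n → Bool} {i : Fin n} {m : List Bool}
    (h : leaderMsg N ID L i = some m) : L i = true ∧ m = idBits N (ID i) := by
  unfold leaderMsg at h
  split_ifs at h with h1
  exact ⟨h1, (Option.some.inj h).symm⟩

omit [NeZero n] in
theorem leaderMsg_of_leader {N : ℕ} {ID : Fin n → ℕ} {L : Fin n → Bool} {i : Fin n}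
    (h : L i = true) : leaderMsg N ID L i = some (idBits N (ID i)) := if_pos h

omit [NeZero n] in
theorem leaderMsg_of_not_leader {N : ℕ} {ID : Fin n → ℕ} {L : Fin n → Bool} {i : Fin n}
    (h : ¬ L i = true) : leaderMsg N ID L i = none := if_neg h

variable {σ : Fin n → ℤˣ} {N : ℕ} {ID : Fin n → ℕ} {L : Fin n → Bool} {d : ℕ}
  {heard : Fin n → Dir → Option (List Bool)}

omit [NeZero n] in
theorem nextLeaders_iff {i : Fin n} : nextLeaders ID L heard i = true ↔
    L i = true ∧ ∀ s m, heard i s = some m → bitsToNat m ≤ ID i := by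
  simp [nextLeaders]

omit [NeZero n] in
theorem leader_of_nextLeaders {i : Fin n} (h : nextLeaders ID L heard i = true) : L i = true :=
  (nextLeaders_iff.1 h).1

/-- The local leader with the largest ID keeps its status. -/
theorem exists_nextLeaders (hIDN : ∀ i, ID i ≤ N) (hL : ∃ i, L i = true)
    (hh : HeardWithin σ N ID L d heard) : ∃ i, nextLeaders ID L heard i = true := by
  obtain ⟨i, hi, hmax⟩ := Finset.exists_max_image (Finset.univ.filter fun i => L i = true) ID
    (by obtain ⟨i, hi⟩ := hL; exact ⟨i, by simpa using hi⟩)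
  have hi : L i = true := by simpa using hi
  refine ⟨i, nextLeaders_iff.2 ⟨hi, fun s m hm => ?_⟩⟩
  -- Going once around the ring leads back to the leader `i`, so a nearest leader exists on each
  -- side and `hh` determines what is heard.
  obtain ⟨h, m', hn⟩ := exists_isNearest σ (leaderMsg N ID L) i s (a := i)
    (by rw [leaderMsg_of_leader hi]; rfl)
  rw [hh i s h m' hn] at hm
  split_ifs at hm
  obtain ⟨h1, h2⟩ := leaderMsg_eq_some hn.eq_some
  rw [← Option.some.inj hm, h2, bitsToNat_idBits (hIDN _)]
  exact hmax _ (by simpa using h1)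

theorem id_le_of_nextLeaders (hIDN : ∀ i, ID i ≤ N) (hh : HeardWithin σ N ID L d heard) {i : Fin n}
    {s : Dir} {h : ℕ} (h0 : 0 < h) (hd : h ≤ d) (hi : nextLeaders ID L heard i = true)
    (hl : L (along σ i s h) = true) (hno : ∀ h', 0 < h' → h' < h → ¬ L (along σ i s h') = true) :
    ID (along σ i s h) ≤ ID i := by
  have hn : IsNearest σ (leaderMsg N ID L) i s h (idBits N (ID (along σ i s h))) :=
    ⟨h0, leaderMsg_of_leader hl, fun h' a b => leaderMsg_of_not_leader (hno h' a b)⟩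
  have hm := hh i s h _ hn
  rw [if_pos hd] at hm
  have := (nextLeaders_iff.1 hi).2 s _ hm
  rwa [bitsToNat_idBits (hIDN _)] at this

theorem exists_side (ε a : ℤˣ) : ∃ s : Dir, a * s.sign = ε := by
  rcases Int.units_eq_one_or a with rfl | rfl <;> rcases Int.units_eq_one_or ε with rfl | rfl
  · exact ⟨.right, rfl⟩
  · exact ⟨.left, rfl⟩
  · exact ⟨.left, rfl⟩
  · exact ⟨.right, rfl⟩

theorem agentAt_add_ne {i : Fin n} {h : ℕ} (h0 : 0 < h) (hn : h < n) :
    agentAt n ((i : ℕ) + h) ≠ i := by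
  intro he
  replace he := he.trans (agentAt_natCast i).symm
  rw [agentAt_eq_iff, add_sub_cancel_left] at he
  have := Nat.le_of_dvd h0 (Int.natCast_dvd_natCast.1 he)
  omega

/-- Take two survivors at distance at most `2 ^ k`. With no old leader between them each has heard
the other, so their identifiers are equal. Otherwise an old leader splits the distance into two
parts, both exceeding `2 ^ k / 2`, which is too long. -/
theorem Separated.nextLeaders (hID : Function.Injective ID) (hIDN : ∀ i, ID i ≤ N)
    {k : ℕ} (hkn : 2 ^ k ≤ n) (hsep : Separated L (2 ^ k / 2))
    (hh : HeardWithin σ N ID L (2 ^ k) heard) : Separated (nextLeaders ID L heard) (2 ^ k) := by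
  classical
  intro i h h0 hd hi hb
  have hex : ∃ h' : ℕ, 0 < h' ∧ L (agentAt n ((i : ℕ) + h')) = true := ⟨h, h0, leader_of_nextLeaders hb⟩
  set h₁ := Nat.find hex with hh₁
  obtain ⟨h₁0, h₁L⟩ := Nat.find_spec hex
  rw [← hh₁] at h₁0 h₁L
  have hmin : ∀ h', 0 < h' → h' < h₁ → ¬ L (agentAt n ((i : ℕ) + h')) = true :=
    fun h' a b c => Nat.find_min hex b ⟨a, c⟩
  have hle : h₁ ≤ h := Nat.find_min' hex ⟨h0, leader_of_nextLeaders hb⟩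
  set b := agentAt n ((i : ℕ) + h) with hbdef
  rcases hle.eq_or_lt with heq | hlt
  -- `s` and `s'` are the sides, in their own senses, on which `i` looks clockwise towards `b` and
  -- `b` looks anticlockwise towards `i`.
  · obtain ⟨s, hs⟩ := exists_side 1 (σ i)
    obtain ⟨s', hs'⟩ := exists_side (-1) (σ b)
    have e1 : ∀ h', along σ i s h' = agentAt n ((i : ℕ) + h') := fun h' => by
      rw [along, hs]; simp
    have e2 : ∀ h' ≤ h, along σ b s' h' = agentAt n ((i : ℕ) + (h - h' : ℕ)) := fun h' hle' => by
      rw [along, hs', hbdef, agentAt_val_add]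
      congr 1
      push_cast [Nat.cast_sub hle']; ring
    have e2h : along σ b s' h = i := by rw [e2 h le_rfl]; simp
    have l1 := id_le_of_nextLeaders hIDN hh h0 hd hi (s := s)
      (by rw [e1]; exact leader_of_nextLeaders hb)
      fun h' a c => by rw [e1]; exact hmin h' a (heq ▸ c)
    have l2 := id_le_of_nextLeaders hIDN hh h0 hd hb (s := s')
      (by rw [e2h]; exact leader_of_nextLeaders hi)
      fun h' a c => by rw [e2 h' c.le]; exact hmin _ (by omega) (by omega)
    rw [e1] at l1
    rw [e2h] at l2
    exact hID (le_antisymm l1 l2)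
  · exfalso
    have a1 : ¬ h₁ ≤ 2 ^ k / 2 := fun hc => agentAt_add_ne h₁0 (by omega)
      (hsep i h₁ h₁0 hc (leader_of_nextLeaders hi) h₁L)
    set c := agentAt n ((i : ℕ) + h₁) with hc
    have hcb : agentAt n ((c : ℕ) + (h - h₁ : ℕ)) = b := by
      rw [hc, agentAt_val_add, hbdef]
      congr 1
      push_cast [Nat.cast_sub hle]; ring
    have a2 : ¬ h - h₁ ≤ 2 ^ k / 2 := fun hc => agentAt_add_ne (i := c) (by omega) (by omega)
      (hsep c (h - h₁) (by omega) hc h₁L (by rw [hcb]; exact leader_of_nextLeaders hb))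
    omega

/-- The arcs of `D` consecutive agents that begin at the marked agents are disjoint. -/
theorem Separated.card_mul_le {D : ℕ} (hsep : Separated L D) (hD : D ≤ n) :
    (Finset.univ.filter fun i => L i = true).card * D ≤ n := by
  have hinj : Set.InjOn (fun q : Fin n × ℕ => agentAt n ((q.1 : ℕ) + q.2))
      ((Finset.univ.filter fun i => L i = true) ×ˢ Finset.range D : Finset (Fin n × ℕ)) := by
    have key : ∀ (a b : Fin n) (s t : ℕ), L a = true → L b = true → s ≤ t → t < D →
        agentAt n ((a : ℕ) + s) = agentAt n ((b : ℕ) + t) → a = b ∧ s = t := by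
      intro a b s t ha hb hst ht h
      have h1 : agentAt n ((b : ℕ) + (t - s : ℕ)) = a := by
        rw [← agentAt_natCast a, agentAt_eq_iff]
        rw [eq_comm, agentAt_eq_iff] at h
        convert h using 1
        push_cast [Nat.cast_sub hst]; ring
      rcases hst.eq_or_lt with rfl | hlt
      · simp only [Nat.sub_self, Nat.cast_zero, add_zero, agentAt_natCast] at h1
        exact ⟨h1.symm, rfl⟩
      · have h2 := hsep b (t - s) (by omega) (by omega) hb (by rw [h1]; exact ha)
        exact absurd h2 (agentAt_add_ne (by omega) (by omega))
    rintro ⟨a, s⟩ ha ⟨b, t⟩ hb h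
    simp only [Finset.coe_product, mem_prod, Finset.mem_coe, Finset.mem_filter, Finset.mem_univ,
      true_and, Finset.mem_range] at ha hb
    rcases le_total s t with hst | hst
    · obtain ⟨rfl, rfl⟩ := key a b s t ha.1 hb.1 hst hb.2 h; rfl
    · obtain ⟨rfl, rfl⟩ := key b a t s hb.1 ha.1 hst ha.2 h.symm; rfl
  have := Finset.card_le_card_of_injOn (t := (Finset.univ : Finset (Fin n))) _
    (fun _ _ => Finset.mem_coe.2 (Finset.mem_univ _)) hinj
  simpa using this

/-! ### The execution of selective families -/

/-- The directions in the round of the set `S`. -/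
def familyDir (ID : Fin n → ℕ) (L : Fin n → Bool) (S : Finset ℕ) (i : Fin n) : Dir :=
  if L i = true ∧ ID i ∈ S then .left else .right

omit [NeZero n] in
-- Turning one agent changes the net velocity by `±2`. Were both assignments trivial, `n` would
-- divide `4`; this is where `4 < n` enters.
theorem not_dvd_netVelocity_of_unique (hn : 4 < n) {d : Fin n → Dir}
    (h0 : (n : ℤ) ∣ 2 * netVelocity σ fun _ => .right) {i : Fin n} (hi : d i = .left)
    (hj : ∀ j, j ≠ i → d j = .right) : ¬ (n : ℤ) ∣ 2 * netVelocity σ d := by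
  intro h
  have e : netVelocity σ (fun _ => .right) - netVelocity σ d = 2 * ((σ i : ℤˣ) : ℤ) := by
    rw [netVelocity, netVelocity, ← Finset.sum_sub_distrib, Finset.sum_eq_single i]
    · rw [velocity, velocity, hi]
      simp only [Dir.sign, mul_one, mul_neg, Units.val_neg]
      ring
    · intro j _ hji
      rw [velocity, velocity, hj j hji, sub_self]
    · simp
  have h1 := dvd_sub h0 h
  rw [← mul_sub, e, ← mul_assoc] at h1
  have h2 := Int.natAbs_dvd_natAbs.2 h1
  rw [Int.natAbs_mul, Int.units_natAbs, Int.natAbs_natCast] at h2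
  have := Nat.le_of_dvd (by norm_num) h2
  norm_num at this
  omega

omit [NeZero n] in
theorem executeFamily_cons (i : Fin n) (S : Finset ℕ) (l : List (Finset ℕ)) :
    executeFamily (L i) (ID i) (S :: l) = testMove (familyDir ID L S i) >>= fun nontrivial =>
      if nontrivial then pure (some (familyDir ID L S i)) else executeFamily (L i) (ID i) l := rfl

theorem exists_run_executeFamily (hy : IsRingLift n y) (σ : Fin n → ℤˣ) (ID : Fin n → ℕ)
    (L : Fin n → Bool) (l : List (Finset ℕ)) :
    ∃ t ≤ 2 * l.length,
      (∃ d q, Run σ (fun i => executeFamily (L i) (ID i) l) (place n y) t (fun i => some (d i)) q ∧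
        GivesNontrivialMove σ q d) ∨
      (Run σ (fun i => executeFamily (L i) (ID i) l) (place n y) t (fun _ => none) (place n y) ∧
        ∀ S ∈ l, (n : ℤ) ∣ 2 * netVelocity σ (familyDir ID L S)) := by
  classical
  induction l with
  | nil => exact ⟨0, le_rfl, Or.inr ⟨Run.halt _ _ _ fun _ => rfl, by simp⟩⟩
  | cons S l ih =>
    have htest := run_testMove hy σ (familyDir ID L S)
    simp only [executeFamily_cons]
    by_cases h : (n : ℤ) ∣ 2 * netVelocity σ (familyDir ID L S)
    · simp only [h, not_true_eq_false, decide_false] at htest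
      rw [place_shift_of_dvd hy h] at htest
      obtain ⟨t, ht, hrun⟩ := ih
      refine ⟨2 + t, by rw [List.length_cons]; omega, ?_⟩
      rcases hrun with ⟨d, q, hrun, hq⟩ | ⟨hrun, hS⟩
      · exact Or.inl ⟨d, q, htest.bind (f := fun i nontrivial =>
          if nontrivial then pure (some (familyDir ID L S i)) else executeFamily (L i) (ID i) l)
          hrun, hq⟩
      · refine Or.inr ⟨htest.bind (f := fun i nontrivial =>
          if nontrivial then pure (some (familyDir ID L S i)) else executeFamily (L i) (ID i) l)
          hrun, fun S' hS' => ?_⟩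
        rcases List.mem_cons.1 hS' with rfl | hS'
        · exact h
        · exact hS S' hS'
    · simp only [h, not_false_eq_true, decide_true] at htest
      refine ⟨2 + 0, by rw [List.length_cons]; omega, Or.inl ⟨_, _, htest.bind (f := fun i nontrivial =>
          if nontrivial then pure (some (familyDir ID L S i)) else executeFamily (L i) (ID i) l)
          (Run.halt _ _ _ fun i => rfl), ?_⟩⟩
      -- The successful test has moved the agents, but the criterion depends only on the directions.
      exact givesNontrivialMove_of_not_dvd (hy.shift _) h

omit [NeZero n] in
/-- A selective family isolates one of the local leaders, if there are not too many of them. -/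
theorem IsSelective.exists_not_dvd {m : ℕ} {l : List (Finset ℕ)} (hl : IsSelective N m l)
    (hn : 4 < n) (hID : Function.Injective ID) (hIDN : ∀ i, 1 ≤ ID i ∧ ID i ≤ N)
    (h0 : (n : ℤ) ∣ 2 * netVelocity σ fun _ => .right) (hL : ∃ i, L i = true)
    (hcard : (Finset.univ.filter fun i => L i = true).card ≤ m) :
    ∃ S ∈ l, ¬ (n : ℤ) ∣ 2 * netVelocity σ (familyDir ID L S) := by
  classical
  obtain ⟨S, hS, h1⟩ := hl.2 ((Finset.univ.filter fun i => L i = true).image ID)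
    (fun a ha => by
      obtain ⟨i, -, rfl⟩ := Finset.mem_image.1 ha
      exact Finset.mem_Icc.2 (hIDN i))
    (by obtain ⟨i, hi⟩ := hL; exact ⟨ID i, Finset.mem_image_of_mem _ (by simpa using hi)⟩)
    (by rwa [Finset.card_image_of_injective _ hID])
  refine ⟨S, hS, ?_⟩
  obtain ⟨a, ha⟩ := Finset.card_eq_one.1 h1
  have ha2 : a ∈ ({a} : Finset ℕ) := Finset.mem_singleton_self a
  rw [← ha, Finset.mem_inter, Finset.mem_image] at ha2
  obtain ⟨⟨i, hi, rfl⟩, hiS⟩ := ha2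
  refine not_dvd_netVelocity_of_unique hn h0 (i := i) (if_pos ⟨by simpa using hi, hiS⟩)
    fun j hj => if_neg fun hjS => hj (hID ?_)
  have : ID j ∈ ({ID i} : Finset ℕ) := by
    rw [← ha, Finset.mem_inter]
    exact ⟨Finset.mem_image_of_mem _ (by simpa using hjS.1), hjS.2⟩
  exact Finset.mem_singleton.1 this

/-! ### The main loop -/

/-- An upper bound on the number of rounds of phase `k` of the main loop. -/
def phaseTime (F : ℕ → ℕ → List (Finset ℕ)) (N k : ℕ) : ℕ :=
  16 * (N.size + 2 ^ k - 1) + 2 * (F N k).length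

/-- The agents do not know `n`, so the scheduled list of phases may go beyond `K`; the invariant on
leaders forces an exit by phase `K`, and only phases up to `K` are charged. -/
theorem exists_run_mainLoop (hy : IsRingLift n y) (hn : 4 < n) (hnN : n ≤ N)
    {F : ℕ → ℕ → List (Finset ℕ)} {c : ℝ} (hF : IsSelectiveScheme c F)
    {nb : Fin n → NeighborInfo} (hnb : KnowsNeighbors y σ nb)
    (hID : Function.Injective ID) (hIDN : ∀ i, 1 ≤ ID i ∧ ID i ≤ N)
    (h0 : (n : ℤ) ∣ 2 * netVelocity σ fun _ => .right) {K : ℕ} (hK : 2 ^ K ≤ n) (hK4 : n ≤ 4 ^ K)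
    (k l : ℕ) (hkK : k ≤ K) (hl : K < k + l) (L : Fin n → Bool) (hL : ∃ i, L i = true)
    (hsep : Separated L (2 ^ k / 2)) :
    ∃ t ≤ ∑ j ∈ Finset.Ico k (K + 1), phaseTime F N j, ∃ d q,
      Run σ (fun i => mainLoop F N (ID i) (nb i) (List.range' k l) (L i)) (place n y) t d q ∧
        GivesNontrivialMove σ q d := by
  induction l generalizing k L with
  | zero => omega
  | succ l ih =>
    have hkn : 2 ^ k ≤ n := (Nat.pow_le_pow_right two_pos hkK).trans hK
    obtain ⟨heard, hrun, hh⟩ := exists_run_disseminate hy hnb (leaderMsg N ID L) (len := N.size)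
      (d := 2 ^ k) (Nat.size_pos.2 (by omega)) (by positivity) (fun i m hm => by
        rw [(leaderMsg_eq_some hm).2, idBits, List.length_map, List.length_range])
    replace hh : HeardWithin σ N ID L (2 ^ k) heard := hh
    have hIDN' : ∀ i, ID i ≤ N := fun i => (hIDN i).2
    have hL' := exists_nextLeaders hIDN' hL hh
    have hsep' := hsep.nextLeaders hID hIDN' hkn hh
    obtain ⟨t, ht, hex⟩ := exists_run_executeFamily hy σ ID (nextLeaders ID L heard) (F N k)
    rw [Finset.sum_eq_sum_Ico_succ_bot (by omega)]
    have hfirst : ∀ {a : Fin n → Option Dir} {q r t' d},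
        Run σ (fun i => executeFamily (nextLeaders ID L heard i) (ID i) (F N k)) (place n y) t a q →
        Run σ (fun i => match a i with
          | some d => pure d
          | none => mainLoop F N (ID i) (nb i) (List.range' (k + 1) l) (nextLeaders ID L heard i))
          q t' d r →
        Run σ (fun i => mainLoop F N (ID i) (nb i) (List.range' k (l + 1)) (L i)) (place n y)
          (16 * (N.size + 2 ^ k - 1) + (t + t')) d r := by
      intro a q r t' d h1 h2
      exact hrun.bind (f := fun i heard => executeFamily
        (L i && @decide (∀ s m, heard s = some m → bitsToNat m ≤ ID i) (Classical.propDecidable _))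
          (ID i) (F N k) >>= fun result => match result with
          | some d => pure d
          | none => mainLoop F N (ID i) (nb i) (List.range' (k + 1) l)
            (L i && @decide (∀ s m, heard s = some m → bitsToNat m ≤ ID i)
              (Classical.propDecidable _))) (h1.bind h2)
    rcases hex with ⟨d, q, h1, h2⟩ | ⟨h1, h2⟩
    · exact ⟨_, by unfold phaseTime; omega, d, q,
        hfirst h1 (Run.halt _ _ _ fun i => rfl), h2⟩
    · have hlt : k < K := by
        refine hkK.lt_of_ne fun hkK => ?_
        have hsel := (hF N k (by omega) (hkn.trans hnN)).1
        -- At `k = K`: the number of leaders times `2 ^ K` is at most `n ≤ 4 ^ K`.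
        have hcard : (Finset.univ.filter fun i => nextLeaders ID L heard i = true).card ≤ 2 ^ k := by
          have h3 := hsep'.card_mul_le hkn
          have h4 : n ≤ 2 ^ k * 2 ^ k := by rw [← mul_pow, hkK]; exact hK4
          exact Nat.le_of_mul_le_mul_right (h3.trans h4) (by positivity)
        obtain ⟨S, hS, hnd⟩ := hsel.exists_not_dvd hn hID hIDN h0 hL' hcard
        exact hnd (h2 S hS)
      obtain ⟨t', ht', d, q, h3, h4⟩ := ih (k + 1) (by omega) (by omega) _ hL'
        (by rwa [pow_succ, Nat.mul_div_cancel _ two_pos])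
      exact ⟨_, by unfold phaseTime at *; omega, d, q, hfirst h1 h3, h4⟩

end

/-! ### Existence of selective families -/

section Selective

open Finset

variable {U : Finset ℕ} {p : ℝ}

theorem insert_inter_eq_singleton {Z T : Finset ℕ} {z : ℕ} (hz : z ∈ Z) (hT : T ⊆ U \ Z) :
    insert z T ∩ Z = {z} := by
  ext a
  simp only [Finset.mem_inter, Finset.mem_insert, Finset.mem_singleton]
  refine ⟨fun ⟨h3, h4⟩ => h3.elim id fun h5 => absurd h4 (Finset.mem_sdiff.1 (hT h5)).2, ?_⟩
  rintro rfl; exact ⟨Or.inl rfl, hz⟩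

theorem insert_sdiff_eq_right {Z T : Finset ℕ} {z : ℕ} (hz : z ∈ Z) (hT : T ⊆ U \ Z) :
    insert z T \ Z = T := by
  ext a
  simp only [Finset.mem_sdiff, Finset.mem_insert]
  refine ⟨fun ⟨h3, h4⟩ => h3.elim (fun h5 => absurd (h5 ▸ hz) h4) id, fun h3 => ?_⟩
  exact ⟨Or.inr h3, (Finset.mem_sdiff.1 (hT h3)).2⟩

/-- The probability that a random subset of `U`, whose elements are chosen independently with
probability `p`, meets `Z` in `z` only. -/
theorem prob_isolated_eq {Z : Finset ℕ} (hZ : Z ⊆ U) {z : ℕ} (hz : z ∈ Z) :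
    ∑ T ∈ (U \ Z).powerset, p ^ (insert z T).card * (1 - p) ^ (U.card - (insert z T).card) =
      p * (1 - p) ^ (Z.card - 1) := by
  have h1 : ∀ T ∈ (U \ Z).powerset,
      p ^ (insert z T).card * (1 - p) ^ (U.card - (insert z T).card) =
        p * (1 - p) ^ (Z.card - 1) * (p ^ T.card * (1 - p) ^ ((U \ Z).card - T.card)) := by
    intro T hT
    rw [Finset.mem_powerset] at hT
    have hzT : z ∉ T := fun h => (Finset.mem_sdiff.1 (hT h)).2 hz
    have c1 := Finset.card_le_card hT
    have c2 := card_sdiff_add_card_eq_card hZ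
    have c3 : 0 < Z.card := card_pos.2 ⟨z, hz⟩
    rw [card_insert_of_notMem hzT,
      show U.card - (T.card + 1) = (Z.card - 1) + ((U \ Z).card - T.card) by omega,
      pow_succ', pow_add]
    exact mul_mul_mul_comm _ _ _ _
  rw [sum_congr rfl h1, ← mul_sum, sum_pow_mul_eq_add_pow, add_sub_cancel, one_pow, mul_one]

/-- The probability that a random subset of `U`, whose elements are chosen independently with
probability `p`, meets `Z` in exactly one element. -/
theorem prob_isolated_ge {Z : Finset ℕ} (hZ : Z ⊆ U) (hp0 : 0 < p) (hp1 : p < 1) :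
    (Z.card : ℝ) * p * (1 - p) ^ (Z.card - 1) ≤
      ∑ S ∈ U.powerset with (Z ∩ S).card = 1, p ^ S.card * (1 - p) ^ (U.card - S.card) := by
  have hq : 0 < 1 - p := by linarith
  -- `z` and `T` are recovered from `S = insert z T` as `S ∩ Z` and `S \ Z`, so the probabilities
  -- for different `z` add up.
  have hinj : Set.InjOn (fun r : ℕ × Finset ℕ => insert r.1 r.2)
      (Z ×ˢ (U \ Z).powerset : Finset (ℕ × Finset ℕ)) := by
    rintro ⟨z, T⟩ h1 ⟨z', T'⟩ h2 h
    replace h1 := Finset.mem_product.1 (Finset.mem_coe.1 h1)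
    replace h2 := Finset.mem_product.1 (Finset.mem_coe.1 h2)
    rw [Finset.mem_powerset] at h1 h2
    change insert z T = insert z' T' at h
    have e1 := insert_inter_eq_singleton h1.1 h1.2
    rw [h, insert_inter_eq_singleton h2.1 h2.2] at e1
    have e2 := insert_sdiff_eq_right h1.1 h1.2
    rw [h, insert_sdiff_eq_right h2.1 h2.2] at e2
    exact Prod.ext (Finset.singleton_injective e1).symm e2.symm
  have hsub : (Z ×ˢ (U \ Z).powerset).image (fun r => insert r.1 r.2) ⊆
      U.powerset.filter fun S => (Z ∩ S).card = 1 := by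
    intro S hS
    obtain ⟨⟨z, T⟩, hr, rfl⟩ := Finset.mem_image.1 hS
    obtain ⟨hz, hT⟩ := Finset.mem_product.1 hr
    rw [Finset.mem_powerset] at hT
    refine Finset.mem_filter.2 ⟨Finset.mem_powerset.2
      (Finset.insert_subset (hZ hz) (hT.trans Finset.sdiff_subset)), ?_⟩
    rw [Finset.inter_comm, insert_inter_eq_singleton hz hT, Finset.card_singleton]
  refine le_trans (le_of_eq ?_) (sum_le_sum_of_subset_of_nonneg hsub fun S _ _ =>
    mul_nonneg (pow_nonneg hp0.le _) (pow_nonneg hq.le _))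
  rw [sum_image hinj, sum_product, sum_congr rfl fun z hz => prob_isolated_eq hZ hz, sum_const,
    nsmul_eq_mul, mul_assoc]

/-- Some subset of `U` isolates an element of at least one eighth of the given sets. -/
theorem exists_isolating {t : ℕ} (ht : 0 < t) (𝒵 : Finset (Finset ℕ))
    (h𝒵 : ∀ Z ∈ 𝒵, Z ⊆ U ∧ Z.card ≤ t ∧ t < 2 * Z.card) :
    ∃ S ⊆ U, (𝒵.card : ℝ) / 8 ≤ (𝒵.filter fun Z => (Z ∩ S).card = 1).card := by
  have ht' : (1 : ℝ) ≤ t := by exact_mod_cast ht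
  -- For sizes in `(t / 2, t]` this makes the expected intersection at least `1 / 4`, while
  -- Bernoulli's inequality bounds the remaining factor below by `1 / 2`.
  set p : ℝ := 1 / (2 * t) with hp
  have hp0 : 0 < p := by positivity
  have hp2 : p ≤ 1 / 2 := by
    rw [hp]; exact one_div_le_one_div_of_le two_pos (by linarith)
  have hpt : p * t = 1 / 2 := by rw [hp]; field_simp
  have hprob : ∀ Z ∈ 𝒵, (1 / 8 : ℝ) ≤
      ∑ S ∈ U.powerset with (Z ∩ S).card = 1, p ^ S.card * (1 - p) ^ (U.card - S.card) := by
    intro Z hZ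
    obtain ⟨h1, h2, h3⟩ := h𝒵 Z hZ
    refine le_trans ?_ (prob_isolated_ge h1 hp0 (by linarith))
    have c1 : (Z.card : ℝ) ≤ t := by exact_mod_cast h2
    have c2 : (t : ℝ) < 2 * Z.card := by exact_mod_cast h3
    have c3 : ((Z.card - 1 : ℕ) : ℝ) ≤ Z.card := by exact_mod_cast Nat.sub_le _ _
    have hb := one_add_mul_le_pow (a := -p) (by linarith) (Z.card - 1)
    rw [← sub_eq_add_neg 1 p] at hb
    have l1 : (1 / 2 : ℝ) ≤ (1 - p) ^ (Z.card - 1) := by nlinarith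
    have l2 : (1 / 4 : ℝ) ≤ Z.card * p := by nlinarith
    nlinarith
  -- The expected number of isolated members of `𝒵` is at least `𝒵.card / 8`, so some `S` attains
  -- this.
  have hsum : ∑ S ∈ U.powerset, p ^ S.card * (1 - p) ^ (U.card - S.card) * ((𝒵.card : ℝ) / 8) ≤
      ∑ S ∈ U.powerset, p ^ S.card * (1 - p) ^ (U.card - S.card) *
        ((𝒵.filter fun Z => (Z ∩ S).card = 1).card : ℝ) := by
    rw [← sum_mul, sum_pow_mul_eq_add_pow, add_sub_cancel, one_pow, one_mul]
    calc (𝒵.card : ℝ) / 8 = ∑ Z ∈ 𝒵, (1 / 8 : ℝ) := by rw [sum_const, nsmul_eq_mul]; ring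
      _ ≤ _ := sum_le_sum hprob
      _ = _ := by
        simp only [sum_filter, card_filter, Nat.cast_sum, mul_sum]
        rw [sum_comm]
        refine sum_congr rfl fun S _ => sum_congr rfl fun Z _ => ?_
        split_ifs <;> simp
  obtain ⟨S, hS, hle⟩ := exists_le_of_sum_le ⟨∅, empty_mem_powerset U⟩ hsum
  refine ⟨S, Finset.mem_powerset.1 hS, le_of_mul_le_mul_left hle ?_⟩
  have : 0 < 1 - p := by linarith
  positivity

/-- Greedy choice: each new set handles an eighth of the members not yet isolated. -/
theorem exists_isolating_list {t : ℕ} (ht : 0 < t) (m : ℕ) (𝒵 : Finset (Finset ℕ))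
    (h𝒵 : ∀ Z ∈ 𝒵, Z ⊆ U ∧ Z.card ≤ t ∧ t < 2 * Z.card) :
    ∃ l : List (Finset ℕ), l.length = m ∧ (∀ S ∈ l, S ⊆ U) ∧
      ((𝒵.filter fun Z => ∀ S ∈ l, (Z ∩ S).card ≠ 1).card : ℝ) ≤ (7 / 8) ^ m * 𝒵.card := by
  induction m generalizing 𝒵 with
  | zero => exact ⟨[], rfl, by simp, by simp⟩
  | succ m ih =>
    obtain ⟨S, hSU, hS⟩ := exists_isolating ht 𝒵 h𝒵
    obtain ⟨l, hl, hlU, hle⟩ := ih (𝒵.filter fun Z => ¬ (Z ∩ S).card = 1)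
      fun Z hZ => h𝒵 Z (Finset.mem_filter.1 hZ).1
    refine ⟨S :: l, by rw [List.length_cons, hl], by simpa using ⟨hSU, hlU⟩, ?_⟩
    have h1 : (𝒵.filter fun Z => ∀ S' ∈ S :: l, (Z ∩ S').card ≠ 1) =
        (𝒵.filter fun Z => ¬ (Z ∩ S).card = 1).filter fun Z => ∀ S' ∈ l, (Z ∩ S').card ≠ 1 := by
      rw [filter_filter]
      simp
    have h2 : ((𝒵.filter fun Z => ¬ (Z ∩ S).card = 1).card : ℝ) ≤ 7 / 8 * 𝒵.card := by
      have := card_filter_add_card_filter_not (s := 𝒵) (fun Z => (Z ∩ S).card = 1)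
      have h3 : ((𝒵.filter fun Z => (Z ∩ S).card = 1).card : ℝ) +
        (𝒵.filter fun Z => ¬ (Z ∩ S).card = 1).card = 𝒵.card := by exact_mod_cast this
      linarith
    rw [h1, pow_succ, mul_assoc]
    exact hle.trans (mul_le_mul_of_nonneg_left h2 (by positivity))

theorem card_small_subsets_le {N t : ℕ} (hN : 2 ≤ N) :
    ((Finset.Icc 1 N).powerset.filter fun Z => Z.card ≤ t).card ≤ N ^ (2 * t) := by
  have h1 : ((Finset.Icc 1 N).powerset.filter fun Z => Z.card ≤ t) ⊆
      (Finset.range (t + 1)).biUnion fun i => (Finset.Icc 1 N).powersetCard i := by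
    intro Z hZ
    obtain ⟨a, b⟩ := Finset.mem_filter.1 hZ
    exact Finset.mem_biUnion.2 ⟨Z.card, Finset.mem_range.2 (by omega),
      mem_powersetCard.2 ⟨Finset.mem_powerset.1 a, rfl⟩⟩
  calc _ ≤ _ := Finset.card_le_card h1
    _ ≤ ∑ i ∈ Finset.range (t + 1), ((Finset.Icc 1 N).powersetCard i).card := card_biUnion_le
    _ ≤ ∑ _i ∈ Finset.range (t + 1), N ^ t := sum_le_sum fun i hi => by
        rw [card_powersetCard, Nat.card_Icc, Nat.add_sub_cancel]
        exact (Nat.choose_le_pow N i).trans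
          (Nat.pow_le_pow_right (by omega) (by rw [Finset.mem_range] at hi; omega))
    _ = (t + 1) * N ^ t := by simp
    _ ≤ N ^ t * N ^ t := Nat.mul_le_mul_right _
        ((Nat.lt_two_pow_self (n := t)).trans_le (Nat.pow_le_pow_left hN t))
    _ = N ^ (2 * t) := by rw [← pow_add, two_mul]

theorem one_le_log {N : ℕ} (hN : 2 < N) : 1 ≤ Real.log N := by
  rw [Real.le_log_iff_exp_le (by positivity)]
  have : (3 : ℝ) ≤ N := by exact_mod_cast hN
  linarith [Real.exp_one_lt_d9]

theorem exists_isolating_list_of_size {N t : ℕ} (hN : 2 < N) (ht : 0 < t) :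
    ∃ l : List (Finset ℕ), (l.length : ℝ) ≤ 17 * t * Real.log N ∧ (∀ S ∈ l, S ⊆ Finset.Icc 1 N) ∧
      ∀ Z ⊆ Finset.Icc 1 N, Z.card ≤ t → t < 2 * Z.card → ∃ S ∈ l, (Z ∩ S).card = 1 := by
  have hlog := one_le_log hN
  have ht' : (1 : ℝ) ≤ t := by exact_mod_cast ht
  have h16 : 0 ≤ 16 * t * Real.log N := by positivity
  -- With `m > 16 * t * log N`, the bound `exp (-m / 8) * N ^ (2 * t)` on the number of remaining
  -- sets is below `1`. The rounding is absorbed by `1 ≤ t * log N`, whence the constant `17`.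
  set m := ⌊16 * t * Real.log N⌋₊ + 1 with hm
  set 𝒵 := (Finset.Icc 1 N).powerset.filter fun Z => Z.card ≤ t ∧ t < 2 * Z.card with h𝒵
  obtain ⟨l, hl, hlU, hle⟩ := exists_isolating_list (U := Finset.Icc 1 N) ht m 𝒵 fun Z hZ => by
    obtain ⟨a, b⟩ := Finset.mem_filter.1 hZ
    exact ⟨Finset.mem_powerset.1 a, b⟩
  refine ⟨l, ?_, hlU, fun Z hZ h1 h2 => ?_⟩
  · rw [hl, hm]
    push_cast
    have := Nat.floor_le h16
    nlinarith
  · by_contra! hcon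
    have hmem : Z ∈ 𝒵.filter fun Z => ∀ S ∈ l, (Z ∩ S).card ≠ 1 :=
      Finset.mem_filter.2 ⟨Finset.mem_filter.2 ⟨Finset.mem_powerset.2 hZ, h1, h2⟩, hcon⟩
    have hpos : (1 : ℝ) ≤ (𝒵.filter fun Z => ∀ S ∈ l, (Z ∩ S).card ≠ 1).card := by
      exact_mod_cast card_pos.2 ⟨Z, hmem⟩
    have hcard : (𝒵.card : ℝ) ≤ Real.exp (2 * t * Real.log N) := by
      have : 𝒵.card ≤ N ^ (2 * t) := (Finset.card_le_card fun Z hZ => by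
        obtain ⟨a, b⟩ := Finset.mem_filter.1 hZ
        exact Finset.mem_filter.2 ⟨a, b.1⟩).trans (card_small_subsets_le (t := t) hN.le)
      have h3 : Real.exp (2 * t * Real.log N) = (N : ℝ) ^ (2 * t) := by
        rw [← Real.exp_log (show (0 : ℝ) < N by positivity), ← Real.exp_nat_mul, Real.log_exp]
        push_cast; rfl
      rw [h3]; exact_mod_cast this
    have hpow : (7 / 8 : ℝ) ^ m ≤ Real.exp (-(m / 8)) := by
      have h4 := Real.add_one_le_exp (-(1 / 8 : ℝ))
      calc (7 / 8 : ℝ) ^ m ≤ Real.exp (-(1 / 8)) ^ m := by gcongr; linarith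
        _ = _ := by rw [← Real.exp_nat_mul]; ring_nf
    have hlt : (m : ℝ) > 16 * t * Real.log N := by
      rw [hm]; push_cast; exact Nat.lt_floor_add_one _
    have : (7 / 8 : ℝ) ^ m * 𝒵.card < 1 := by
      calc (7 / 8 : ℝ) ^ m * 𝒵.card ≤ Real.exp (-(m / 8)) * Real.exp (2 * t * Real.log N) := by
            gcongr
        _ < 1 := by rw [← Real.exp_add, Real.exp_lt_one_iff]; linarith
    linarith

/-- Each step adds a list for the sizes in `(2 ^ k, 2 ^ (k + 1)]`; the lengths form a geometric sum,
which doubles the constant `17`. -/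
theorem exists_isSelective {N : ℕ} (hN : 2 < N) (k : ℕ) :
    ∃ l, IsSelective N (2 ^ k) l ∧ (l.length : ℝ) ≤ 34 * 2 ^ k * Real.log N := by
  have hlog := one_le_log hN
  induction k with
  | zero =>
    obtain ⟨l, h1, h2, h3⟩ := exists_isolating_list_of_size hN (t := 1) one_pos
    refine ⟨l, ⟨h2, fun Z hZ hne hc => h3 Z hZ hc ?_⟩, ?_⟩
    · have := card_pos.2 hne; omega
    · push_cast at h1; linarith
  | succ k ih =>
    obtain ⟨l, ⟨h1, h2⟩, h3⟩ := ih
    obtain ⟨l', h1', h2', h3'⟩ := exists_isolating_list_of_size hN (t := 2 ^ (k + 1)) (by positivity)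
    refine ⟨l ++ l', ⟨fun S hS => ?_, fun Z hZ hne hc => ?_⟩, ?_⟩
    · exact (List.mem_append.1 hS).elim (h1 S) (h2' S)
    · by_cases hk : Z.card ≤ 2 ^ k
      · obtain ⟨S, hS, h⟩ := h2 Z hZ hne hk
        exact ⟨S, List.mem_append_left _ hS, h⟩
      · obtain ⟨S, hS, h⟩ := h3' Z hZ hc (by rw [pow_succ]; omega)
        exact ⟨S, List.mem_append_right _ hS, h⟩
    · rw [List.length_append]
      push_cast at h1' ⊢
      rw [pow_succ] at h1' ⊢
      linarith

theorem exists_isSelectiveScheme :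
    ∃ (c : ℝ) (F : ℕ → ℕ → List (Finset ℕ)), IsSelectiveScheme c F := by
  classical
  have h : ∀ N k, ∃ l, 2 < N → IsSelective N (2 ^ k) l ∧
      (l.length : ℝ) ≤ 34 * 2 ^ k * Real.log N := fun N k => by
    by_cases hN : 2 < N
    · obtain ⟨l, hl⟩ := exists_isSelective hN k
      exact ⟨l, fun _ => hl⟩
    · exact ⟨[], fun h => absurd h hN⟩
  choose F hF using h
  exact ⟨34, F, fun N k hN _ => hF N k hN⟩

end Selective

/-! ### The algorithm -/

noncomputable section

variable {n : ℕ} [NeZero n]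

/-- The lifts of the positions of the agents. -/
def ringLift (x : Fin n → ℝ) (k : ℤ) : ℝ := x (agentAt n k) + ((k / n : ℤ) : ℝ)

theorem isRingLift_ringLift {x : Fin n → ℝ} (hx : StrictMono x)
    (hx1 : ∀ i, x i ∈ Set.Ico (0 : ℝ) 1) : IsRingLift n (ringLift x) where
  mono := by
    have hn := intCast_pos_of_neZero (n := n)
    refine strictMono_int_of_lt_succ fun k => ?_
    have e1 := agentAt_val (n := n) k
    have e2 := agentAt_val (n := n) (k + 1)
    have d1 := Int.emod_add_mul_ediv k n
    have d2 := Int.emod_add_mul_ediv (k + 1) n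
    have b1 := Int.emod_nonneg k hn.ne'
    have b2 := Int.emod_lt_of_pos k hn
    have b3 := Int.emod_nonneg (k + 1) hn.ne'
    have b4 := Int.emod_lt_of_pos (k + 1) hn
    unfold ringLift
    have hle : k / n ≤ (k + 1) / n := Int.ediv_le_ediv hn (by linarith)
    rcases hle.eq_or_lt with h | h
    · rw [← h]
      rw [← h] at d2
      have : agentAt n k < agentAt n (k + 1) := by
        rw [Fin.lt_def, ← Int.ofNat_lt, e1, e2]; linarith
      linarith [hx this]
    · have h1 : ((k / n : ℤ) : ℝ) + 1 ≤ (((k + 1) / n : ℤ) : ℝ) := by exact_mod_cast h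
      linarith [(hx1 (agentAt n k)).2, (hx1 (agentAt n (k + 1))).1]
  period k := by
    have hn := intCast_pos_of_neZero (n := n)
    unfold ringLift
    rw [agentAt_add_period, Int.add_ediv_of_dvd_right (dvd_refl _), Int.ediv_self hn.ne']
    push_cast; ring

theorem place_ringLift (x : Fin n → ℝ) : place n (ringLift x) = fun i => (x i : UnitAddCircle) := by
  funext i
  have : ((i : ℕ) : ℤ) / n = 0 := Int.ediv_eq_zero_of_lt (by positivity) (by exact_mod_cast i.2)
  rw [place, ringLift, this, agentAt_natCast, Int.cast_zero, add_zero]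

/-! ### The last phase and the number of rounds -/

theorem exists_exponent {n : ℕ} (hn : 4 < n) :
    ∃ K, n ≤ 4 ^ K ∧ 2 ^ K ≤ n ∧ (2 : ℝ) ^ K ≤ 2 * Real.sqrt n := by
  have hex : ∃ K, n ≤ 4 ^ K := ⟨n, (Nat.lt_pow_self (by norm_num)).le⟩
  -- Minimality gives `4 ^ K ≤ 4 * n`, hence `2 ^ K ≤ 2 * √n`, and also `2 ^ K ≤ n` because `n > 4`.
  set K := Nat.find hex with hK
  have h1 : n ≤ 4 ^ K := Nat.find_spec hex
  obtain ⟨k, hk⟩ : ∃ k, K = k + 1 :=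
    Nat.exists_eq_succ_of_ne_zero fun h => by rw [h] at h1; norm_num at h1; omega
  have h2 : 4 ^ k < n := not_le.1 (Nat.find_min hex (by omega))
  have h3 : 2 ^ K * 2 ^ K ≤ 4 * n := by
    rw [← mul_pow, hk, pow_succ]; norm_num; omega
  refine ⟨K, h1, by nlinarith, ?_⟩
  have h4 : ((2 : ℝ) ^ K / 2) ≤ Real.sqrt n := by
    apply Real.le_sqrt_of_sq_le
    have : ((2 : ℝ) ^ K * 2 ^ K) ≤ 4 * n := by exact_mod_cast h3
    nlinarith
  linarith

theorem size_le_log {N : ℕ} (hN : 2 < N) : (N.size : ℝ) ≤ 3 * Real.log N := by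
  have hlog := one_le_log hN
  have h0 : 0 < N.size := Nat.size_pos.2 (by omega)
  have h1 : 2 ^ (N.size - 1) ≤ N := Nat.lt_size.1 (by omega)
  have h2 : (2 : ℝ) ^ (N.size - 1) ≤ N := by exact_mod_cast h1
  have h3 := Real.log_le_log (by positivity) h2
  rw [Real.log_pow, Nat.cast_sub h0] at h3
  push_cast at h3
  have := Real.log_two_gt_d9
  have h4 : (1 : ℝ) ≤ N.size := by exact_mod_cast h0
  nlinarith

theorem sum_phaseTime_le {F : ℕ → ℕ → List (Finset ℕ)} {c : ℝ} (hF : IsSelectiveScheme c F)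
    {N K : ℕ} (hN : 2 < N) (hK : 2 ^ K ≤ N) :
    ((∑ j ∈ Finset.Ico 0 (K + 1), phaseTime F N j : ℕ) : ℝ) ≤
      16 * (K + 1) * N.size + (32 + 4 * |c| * Real.log N) * 2 ^ K := by
  have hlog := one_le_log hN
  have hphase : ∀ j ∈ Finset.range (K + 1), (phaseTime F N j : ℝ) ≤
      16 * N.size + (16 + 2 * |c| * Real.log N) * 2 ^ j := by
    intro j hj
    have h1 := (hF N j hN ((Nat.pow_le_pow_right two_pos
      (by rw [Finset.mem_range] at hj; omega)).trans hK)).2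
    -- The sign of `c` is not given, so the bound is stated with `|c|`.
    have h2 : c * (2 ^ j * Real.log N) ≤ |c| * (2 ^ j * Real.log N) :=
      mul_le_mul_of_nonneg_right (le_abs_self c) (by positivity)
    have h3 : ((N.size + 2 ^ j - 1 : ℕ) : ℝ) ≤ N.size + 2 ^ j := by
      exact_mod_cast Nat.sub_le _ _
    rw [phaseTime]
    push_cast
    linarith
  have hgeom : ∑ j ∈ Finset.range (K + 1), (2 : ℝ) ^ j ≤ 2 * 2 ^ K := by
    rw [geom_sum_eq (by norm_num), pow_succ]; norm_num; linarith
  rw [← Finset.range_eq_Ico]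
  push_cast
  refine (Finset.sum_le_sum hphase).trans ?_
  rw [Finset.sum_add_distrib, Finset.sum_const, Finset.card_range, nsmul_eq_mul, ← Finset.mul_sum]
  have := mul_le_mul_of_nonneg_left hgeom
    (show 0 ≤ 16 + 2 * |c| * Real.log N by positivity)
  push_cast
  linarith

theorem exists_run_NMoveS {y : ℤ → ℝ} (hy : IsRingLift n y) {N : ℕ} (hn : 4 < n) (hnN : n ≤ N)
    {F : ℕ → ℕ → List (Finset ℕ)} {c : ℝ} (hF : IsSelectiveScheme c F) (σ : Fin n → ℤˣ)
    {ID : Fin n → ℕ} (hID : Function.Injective ID) (hIDN : ∀ i, 1 ≤ ID i ∧ ID i ≤ N) :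
    ∃ t d q, Run σ (fun i => NMoveS F N (ID i)) (place n y) t d q ∧
      (t : ℝ) ≤ (220 + 8 * |c|) * (Real.sqrt n * Real.log N) ∧ GivesNontrivialMove σ q d := by
  classical
  have hN : 2 < N := by omega
  have hlog := one_le_log hN
  obtain ⟨K, hK4, hKn, hKs⟩ := exists_exponent hn
  have hsqrt : 1 ≤ Real.sqrt n := Real.one_le_sqrt.2 (by exact_mod_cast (by omega : 1 ≤ n))
  have htest := run_testMove hy σ fun _ => Dir.right
  by_cases h0 : (n : ℤ) ∣ 2 * netVelocity σ fun _ => Dir.right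
  · simp only [h0, not_true_eq_false, decide_false] at htest
    rw [place_shift_of_dvd hy h0] at htest
    obtain ⟨nb, hdisc, hnb⟩ := exists_run_neighborDiscovery hy (by omega) σ hID
      fun i => (hIDN i).2
    obtain ⟨t, ht, d, q, hrun, hq⟩ := exists_run_mainLoop hy hn hnN hF hnb hID hIDN h0 hKn hK4 0
      (Nat.log 2 N + 1) (Nat.zero_le _)
      (by have := Nat.le_log_of_pow_le one_lt_two (hKn.trans hnN); omega)
      -- Initially all agents lead; the required separation `2 ^ 0 / 2 = 0` is empty.
      (fun _ => true) ⟨0, rfl⟩ (fun i h h0 h1 => by simp at h1; omega)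
    rw [← List.range_eq_range'] at hrun
    refine ⟨2 + ((8 * N.size + 4) + t), d, q, ?_, ?_, hq⟩
    · exact htest.bind (f := fun i nontrivial => if nontrivial then pure Dir.right else
        neighborDiscovery N (ID i) >>= fun nb =>
          mainLoop F N (ID i) nb (List.range (Nat.log 2 N + 1)) true) (hdisc.bind hrun)
    · have h1 : (t : ℝ) ≤ _ := (Nat.cast_le.2 ht).trans
        (sum_phaseTime_le hF hN (hKn.trans hnN))
      have hS := size_le_log hN
      have hK1 : ((K : ℝ) + 1) ≤ 2 ^ K := by exact_mod_cast Nat.lt_two_pow_self (n := K)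
      have hQ : (1 : ℝ) ≤ 2 ^ K := one_le_pow₀ one_le_two
      push_cast
      set Q : ℝ := 2 ^ K
      set l := Real.log N
      have hQl : 1 ≤ Q * l := one_le_mul_of_one_le_of_one_le hQ hlog
      have m1 : ((K : ℝ) + 1) * N.size ≤ Q * (3 * l) :=
        mul_le_mul hK1 hS (by positivity) (by linarith)
      have m2 : l ≤ Q * l := le_mul_of_one_le_left (by linarith) hQ
      have m3 : Q ≤ Q * l := le_mul_of_one_le_right (by linarith) hlog
      have m4 : Q * l ≤ 2 * (Real.sqrt n * l) := by
        rw [← mul_assoc]; exact mul_le_mul_of_nonneg_right hKs (by linarith)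
      -- In units of `Q * l` the cost is at most `6` for constants, `24` for discovery, `48 + 32`
      -- for dissemination and `4 * |c|` for the families; `Q ≤ 2 * √n` doubles the total.
      have m5 := mul_le_mul_of_nonneg_left m4 (show 0 ≤ 110 + 4 * |c| by positivity)
      linarith
  · simp only [h0, not_false_eq_true, decide_true] at htest
    refine ⟨2 + 0, fun _ => Dir.right, place n fun k => y (k + 2 * netVelocity σ fun _ => Dir.right),
      ?_, ?_, ?_⟩
    · exact htest.bind (f := fun i nontrivial => if nontrivial then pure Dir.right else
        neighborDiscovery N (ID i) >>= fun nb =>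
          mainLoop F N (ID i) nb (List.range (Nat.log 2 N + 1)) true)
        (Run.halt _ _ _ fun i => rfl)
    · have h1 := one_le_mul_of_one_le_of_one_le hsqrt hlog
      push_cast
      nlinarith [abs_nonneg c]
    · exact givesNontrivialMove_of_not_dvd (hy.shift _) h0

end

theorem mainTheorem6 :
    (∃ (c : ℝ) (F : ℕ → ℕ → List (Finset ℕ)), IsSelectiveScheme c F) ∧
    ∀ c : ℝ, ∃ C : ℝ, ∀ F : ℕ → ℕ → List (Finset ℕ), IsSelectiveScheme c F →
      ∀ N n : ℕ, 4 < n → n ≤ N →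
      ∀ x : Fin n → ℝ, StrictMono x → (∀ i, x i ∈ Set.Ico (0 : ℝ) 1) →
      ∀ σ : Fin n → ℤˣ,
      ∀ ID : Fin n → ℕ, Function.Injective ID → (∀ i, 1 ≤ ID i ∧ ID i ≤ N) →
        SolvesNontrivialMoveWithin σ (fun i => (x i : UnitAddCircle))
          (fun i => NMoveS F N (ID i)) (C * (Real.sqrt n * Real.log N)) := by
  refine ⟨exists_isSelectiveScheme, fun c => ⟨220 + 8 * |c|, ?_⟩⟩
  intro F hF N n hn hnN x hx hx1 σ ID hID hIDN
  have : NeZero n := ⟨by omega⟩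
  obtain ⟨t, d, q, hrun, ht, hq⟩ :=
    exists_run_NMoveS (isRingLift_ringLift hx hx1) hn hnN hF σ hID hIDN
  rw [place_ringLift] at hrun
  refine ⟨⟨t, d, q, hrun⟩, fun t' d' q' h' => ?_⟩
  -- By determinism every run is the constructed one.
  obtain ⟨rfl, rfl, rfl⟩ := hrun.unique 0 h'
  exact ⟨ht, hq⟩
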